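/- Let $K$ be an algebraically closed field of characteristic zero (for instance $\bar{\mathbb{Q}}_\ell$), let $V$ be a $K$-vector space of finite dimension $2n$, and let $0\le d\le d'$ be integers. For a sequence $\lambda=(\lambda_1\ge\dots\ge\lambda_m\ge 0)$ of integers let $V^\lambda$ be the representation of $\mathrm{GL}(V)$ obtained by evaluating the polynomial functor of $\lambda$ at $V$, i.e. the image in $V^{\otimes(\lambda_1+\dots+\lambda_m)}$ of the Young symmetrizer of the diagram with row lengths $\lambda_1,\dots,\lambda_m$ (symmetrization along the rows followed by antisymmetrization along the columns), so that $V^{(r)}=\mathrm{Sym}^r V$ and $V^{(1^r)}=\wedge^r V$. Then there is an isomorphism of representations of $\mathrm{GL}(V)$ $$\mathrm{Sym}^d(\wedge^2 V)\otimes \mathrm{Sym}^{d'-d}V\;\cong\;\bigoplus_\lambda V^\lambda,$$ where $\lambda$ runs over all sequences of integers $\lambda_1\ge\lambda_2\ge\dots\ge\lambda_{2n}\ge 0$ with $\lambda_1+\dots+\lambda_{2n}=d+d'$ such that $\lambda^{\mathrm{odd}}=(\lambda_1,\lambda_3,\dots,\lambda_{2n-1})$ is a weakly decreasing sequence of nonnegative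 integers with sum $d'$ and $\lambda^{\mathrm{even}}=(\lambda_2,\lambda_4,\dots,\lambda_{2n})$ is a weakly decreasing sequence of nonnegative integers with sum $d$. In particular, the representation is multiplicity free: the $V^\lambda$ occurring are irreducible and pairwise non-isomorphic, and the representation is completely reducible, with every irreducible representation of $\mathrm{GL}(V)$ mapping to it by an at most one-dimensional space of intertwining maps. -/

import Mathlib

open scoped TensorProduct

noncomputable section

/-! ### Weights -/

/-- The dominant weights `lam 0 ≥ lam 1 ≥ ... ≥ lam (m - 1) ≥ 0` with `m` nonnegative integer
entries and of degree (sum of the entries) `d`. -/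
def DominantWeights (m d : ℕ) : Set (Fin m → ℕ) :=
  {lam | Antitone lam ∧ ∑ i, lam i = d}

/-- The entries of `lam` in the positions 1, 3, 5, ..., `2n - 1`, where positions are counted
from 1 (so these are the indices 0, 2, 4, ... of `Fin (2 * n)`). -/
def oddPart {n : ℕ} (lam : Fin (2 * n) → ℕ) : Fin n → ℕ :=
  fun i => lam ⟨2 * i.1, by omega⟩

/-- The entries of `lam` in the positions 2, 4, 6, ..., `2n`, where positions are counted
from 1 (so these are the indices 1, 3, 5, ... of `Fin (2 * n)`). -/
def evenPart {n : ℕ} (lam : Fin (2 * n) → ℕ) : Fin n → ℕ :=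
  fun i => lam ⟨2 * i.1 + 1, by omega⟩

/-- The dominant weights of length `2n` and degree `d + d'` whose odd part is a dominant weight of
degree `d'` and whose even part is a dominant weight of degree `d`. -/
def WeightIndex (n d d' : ℕ) : Set (Fin (2 * n) → ℕ) :=
  {lam | lam ∈ DominantWeights (2 * n) (d + d') ∧
    oddPart lam ∈ DominantWeights n d' ∧ evenPart lam ∈ DominantWeights n d}

/-! ### Symmetric and exterior powers of a representation -/

section Powers

variable {K G W : Type*} [Field K] [Monoid G] [AddCommGroup W] [Module K W]

variable (K W) in
/-- The symmetric power `Sym^d W`: the homogeneous component of degree `d` of the symmetric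
algebra of `W`, i.e. the span of all products of `d` elements of `W`. -/
def symPower (d : ℕ) : Submodule K (SymmetricAlgebra K W) :=
  LinearMap.range (SymmetricAlgebra.ι K W) ^ d

/-- The algebra endomorphism of the symmetric algebra of `W` induced by a linear endomorphism. -/
def symAlgMap (f : W →ₗ[K] W) : SymmetricAlgebra K W →ₐ[K] SymmetricAlgebra K W :=
  SymmetricAlgebra.lift (SymmetricAlgebra.ι K W ∘ₗ f)

/-- The action on the symmetric algebra by algebra automorphisms induced by a representation. -/
def symAlgRep (ρ : Representation K G W) : Representation K G (SymmetricAlgebra K W) where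
  toFun g := (symAlgMap (ρ g)).toLinearMap
  map_one' := by
    have h : symAlgMap (ρ 1) = AlgHom.id K (SymmetricAlgebra K W) := by
      apply SymmetricAlgebra.algHom_ext
      ext x
      simp [symAlgMap]
    rw [h]
    rfl
  map_mul' g h := by
    have e : symAlgMap (ρ (g * h)) = (symAlgMap (ρ g)).comp (symAlgMap (ρ h)) := by
      apply SymmetricAlgebra.algHom_ext
      ext x
      simp [symAlgMap]
    rw [e]
    rfl

theorem symPower_le_comap (ρ : Representation K G W) (d : ℕ) (g : G) :
    symPower K W d ≤ (symPower K W d).comap (symAlgRep ρ g) := by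
  rw [← Submodule.map_le_iff_le_comap]
  change Submodule.map (symAlgMap (ρ g)).toLinearMap (LinearMap.range _ ^ d) ≤ _
  rw [Submodule.map_pow]
  refine pow_le_pow_left' ?_ d
  rintro _ ⟨_, ⟨x, rfl⟩, rfl⟩
  exact ⟨ρ g x, by simp [symAlgMap]⟩

/-- The representation `Sym^d W` of `G` attached to a representation `W` of `G`. -/
def symPowerRep (d : ℕ) (ρ : Representation K G W) : Representation K G (symPower K W d) :=
  (symAlgRep ρ).subrepresentation (symPower K W d) (symPower_le_comap ρ d)

/-- The representation `⋀^k W` of `G` attached to a representation `W` of `G`. -/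
def extPowerRep (k : ℕ) (ρ : Representation K G W) : Representation K G (⋀[K]^k W) where
  toFun g := exteriorPower.map k (ρ g)
  map_one' := by
    rw [map_one]
    exact exteriorPower.map_id
  map_mul' g h := by
    rw [map_mul]
    exact exteriorPower.map_comp (ρ h) (ρ g)

end Powers

/-! ### The polynomial functors `V ↦ V^lam` -/

section Schur

variable {K G V : Type*} [Field K] [Monoid G] [AddCommGroup V] [Module K V] {m : ℕ}

/-- The cells of the Young diagram with row lengths `lam 0, lam 1, ...`: the cell `⟨i, j⟩` lies in
row `i` and column `j`. -/
abbrev Cell (lam : Fin m → ℕ) : Type := Σ i : Fin m, Fin (lam i)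

variable (K V) in
/-- The tensor power of `V` with one factor for each cell of the diagram `lam`. -/
abbrev CellTensor (lam : Fin m → ℕ) : Type _ := ⨂[K] _ : Cell lam, V

variable (K V) in
/-- The permutation of tensor factors given by a permutation of the cells. -/
def permFactors {lam : Fin m → ℕ} (s : Equiv.Perm (Cell lam)) :
    CellTensor K V lam →ₗ[K] CellTensor K V lam :=
  (PiTensorProduct.reindex K (fun _ : Cell lam => V) s).toLinearMap

open Classical in
variable (K V) in
/-- The row symmetrizer: the sum of all permutations that preserve every row. -/
def rowSymmetrizer (lam : Fin m → ℕ) : CellTensor K V lam →ₗ[K] CellTensor K V lam :=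
  ∑ s : Equiv.Perm (Cell lam) with ∀ c, (s c).1 = c.1, permFactors K V s

open Classical in
variable (K V) in
/-- The column antisymmetrizer: the signed sum of all permutations that preserve every column. -/
def colAntisymmetrizer (lam : Fin m → ℕ) : CellTensor K V lam →ₗ[K] CellTensor K V lam :=
  ∑ s : Equiv.Perm (Cell lam) with ∀ c, ((s c).2 : ℕ) = (c.2 : ℕ),
    ((Equiv.Perm.sign s : ℤ) : K) • permFactors K V s

variable (K V) in
/-- Weyl's construction of `V^lam`: the image of the Young symmetrizer of the diagram `lam` on the
tensor power of `V` indexed by the cells of the diagram. -/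
def schurSubmodule (lam : Fin m → ℕ) : Submodule K (CellTensor K V lam) :=
  LinearMap.range (colAntisymmetrizer K V lam ∘ₗ rowSymmetrizer K V lam)

/-- The diagonal action of `G` on the tensor power of `V`. -/
def cellTensorRep (lam : Fin m → ℕ) (ρ : Representation K G V) :
    Representation K G (CellTensor K V lam) where
  toFun g := PiTensorProduct.map fun _ => ρ g
  map_one' := by
    simp only [map_one]
    exact PiTensorProduct.map_one
  map_mul' g h := by
    simp only [map_mul]
    exact PiTensorProduct.map_mul _ _

theorem permFactors_comm {lam : Fin m → ℕ} (ρ : Representation K G V) (g : G)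
    (s : Equiv.Perm (Cell lam)) :
    cellTensorRep lam ρ g ∘ₗ permFactors K V s = permFactors K V s ∘ₗ cellTensorRep lam ρ g :=
  PiTensorProduct.map_comp_reindex_eq (fun _ : Cell lam => ρ g) s

theorem schurSubmodule_le_comap (lam : Fin m → ℕ) (ρ : Representation K G V) (g : G) :
    schurSubmodule K V lam ≤ (schurSubmodule K V lam).comap (cellTensorRep lam ρ g) := by
  have hs (s : Equiv.Perm (Cell lam)) (x : CellTensor K V lam) :
      cellTensorRep lam ρ g (permFactors K V s x) = permFactors K V s (cellTensorRep lam ρ g x) :=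
    LinearMap.congr_fun (permFactors_comm ρ g s) x
  rintro _ ⟨x, rfl⟩
  refine ⟨cellTensorRep lam ρ g x, ?_⟩
  simp only [rowSymmetrizer, colAntisymmetrizer, LinearMap.comp_apply, LinearMap.sum_apply,
    LinearMap.smul_apply, map_sum, map_smul, hs]

/-- The representation `V^lam` of `G` attached to a representation `V` of `G`. -/
def schurRep (lam : Fin m → ℕ) (ρ : Representation K G V) :
    Representation K G (schurSubmodule K V lam) :=
  (cellTensorRep lam ρ).subrepresentation (schurSubmodule K V lam) (schurSubmodule_le_comap lam ρ)

end Schur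

/-! ### The group `GL(V)` and multiplicity-freeness -/

/-- The tautological representation of `GL(V)` on `V`. -/
def stdRep (K V : Type*) [Field K] [AddCommGroup V] [Module K V] :
    Representation K (LinearMap.GeneralLinearGroup K V) V :=
  Units.coeHom (V →ₗ[K] V)

/-- A representation is multiplicity free if it is completely reducible and the space of
intertwining maps from each irreducible representation to it is at most one-dimensional. -/
def IsMultiplicityFree.{u, v, w} {K : Type u} {G : Type v} {W : Type w} [Field K] [Monoid G]
    [AddCommGroup W] [Module K W] (ρ : Representation K G W) : Prop :=
  ρ.IsSemisimpleRepresentation ∧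
    ∀ (U : Type w) [AddCommGroup U] [Module K U] (σ : Representation K G U),
      σ.IsIrreducible → Module.rank K (σ.IntertwiningMap ρ) ≤ 1

end

/-!
Let `e` be a basis of `V`, indexed by `Fin (2 * n)`, let `B` be the group of elements of `GL(V)`
which are upper triangular with respect to `e`, and let `M = Sym^d(⋀² V) ⊗ Sym^k V`, `k = d' - d`.
The proof is by the theory of highest weight vectors, i.e. eigenvectors of `B`, developed for
homomorphic images `E` of tensor powers of `V` only.

* Tensor powers are completely reducible: the endomorphisms commuting with the permutations of the
  factors are spanned by the operators of `GL(V)`, which is Zariski dense in `End(V)`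
  (`mem_span_range_tensorRep`), and they form a semisimple ring by Maschke's theorem for the
  symmetric group (`isSemisimple_tensorRep`).
* Every nonzero subrepresentation of `E` contains a highest weight vector, of dominant weight
  (`exists_isHighestWeightVector`).
* `V^lam` is irreducible (`isIrreducible_schurRep`), contains a highest weight vector of weight `lam`
  (`isHighestWeightVector_schurVec`), and determines `lam` (`eq_of_schurRep_equiv`).

It remains to find the highest weight vectors of `M`. The elements of `M` are polynomial functions
of an alternating form `ω` and a linear form `ξ` on `V`. The orbit of `B` at the pair `(ω₀, ξ₀)`
for which `e (2i)`, `e (2i + 1)` are hyperbolic pairs and `ξ₀` is `1` on `e (2i)` and `0` on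
`e (2i + 1)` is open: the tangent vectors of `B` move the pair in every direction
(`exists_tangent`). Hence a highest weight vector is determined by its weight and its value at
`(ω₀, ξ₀)`, which is not zero (`IsHighestWeightVector.evalAt_base_ne_zero`), so `M` is multiplicity
free (`IsHighestWeightVector.exists_eq_smul`). The elements of the torus which multiply the
`e (2i)` by `a` and the `e (2i + 1)` by `b` multiply the pair by `(ab, a)`, and this shows that the
weight is in `WeightIndex n d d'` (`IsHighestWeightVector.sum_parts`).

Conversely, for `lam` in `WeightIndex n d d'` the diagram is a union of `d` vertical dominoes, with
upper cells in even rows, and `k` single cells in even rows, rows being numbered from `0`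
(`exists_isCellPairing`). Multiplying out accordingly gives a map from `V^lam` to `M`. The value at
`(ω₀, ξ₀)` of the image of the highest weight vector is a positive multiple of the number of
column preserving permutations of the cells which map dominoes to pairs of cells in rows `2i`,
`2i + 1`: the sign of such a permutation is given by the parity of the number of dominoes it turns
upside down, and so is the sign of the product of the values of `ω₀` (`IsCellPairing.sign_eq`). So
the map is not zero (`schurToSymTensor_schurVec_ne_zero`). The sum of these maps is injective by
Schur's lemma and surjective because its image contains all highest weight vectors of `M`
(`nonempty_equiv_directSum`).
-/

noncomputable section

/-! ### Polynomial families of vectors -/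

section Density

variable {K : Type*} [Field K] [CharZero K]

/-- If a polynomial family of vectors, given as a sum of monomials times vectors, lies in a subspace
away from a hypersurface, then so does the sum of the vectors belonging to each monomial. -/
theorem sum_coeff_mem {E σ A : Type*} [AddCommGroup E] [Module K E] [Fintype σ]
    (W : Submodule K E) (s : Finset A) (μ : A → σ → ℕ) (y : A → E)
    (D : MvPolynomial σ K) (hD : D ≠ 0)
    (h : ∀ t : σ → K, MvPolynomial.eval t D ≠ 0 → ∑ a ∈ s, (∏ i, t i ^ μ a i) • y a ∈ W)
    (ν : σ → ℕ) [DecidablePred fun a => μ a = ν] : ∑ a ∈ s with μ a = ν, y a ∈ W := by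
  classical
  by_contra hmem
  obtain ⟨l, hl, hW⟩ := Submodule.exists_le_ker_of_notMem hmem
  set p : MvPolynomial σ K :=
    ∑ a ∈ s, MvPolynomial.monomial (Finsupp.equivFunOnFinite.symm (μ a)) (l (y a)) with hp
  have hev (t : σ → K) : MvPolynomial.eval t p = l (∑ a ∈ s, (∏ i, t i ^ μ a i) • y a) := by
    simp only [hp, map_sum, map_smul, smul_eq_mul, MvPolynomial.eval_monomial]
    refine Finset.sum_congr rfl fun a _ => ?_
    rw [Finsupp.prod_fintype _ _ (by simp), mul_comm]
    rfl
  have hDp : D * p = 0 := by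
    refine MvPolynomial.funext fun t => ?_
    rw [map_mul, map_zero, mul_eq_zero, or_iff_not_imp_left, hev]
    exact fun ht => hW (h t ht)
  have hp0 : p = 0 := (mul_eq_zero.mp hDp).resolve_left hD
  apply hl
  have := congrArg (MvPolynomial.coeff (Finsupp.equivFunOnFinite.symm ν)) hp0
  rw [hp, MvPolynomial.coeff_sum] at this
  simp only [MvPolynomial.coeff_monomial, MvPolynomial.coeff_zero,
    EmbeddingLike.apply_eq_iff_eq] at this
  rw [map_sum, Finset.sum_filter]
  convert this

/-- Polarization: if a multilinear map is symmetric in each of the groups of variables given by `r`,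
then its values are spanned by the values at families that are constant on the groups. The vector
`φ v` is, up to a positive integer, the coefficient of `∏ i, t i` in the value at the family of the
sums of the `t j • v j` over the groups. -/
theorem MultilinearMap.mem_of_forall_comp_mem {ι κ V E : Type*} [Fintype ι] [AddCommGroup V]
    [Module K V] [AddCommGroup E] [Module K E] (r : ι → κ)
    (φ : MultilinearMap K (fun _ : ι => V) E) (W : Submodule K E)
    (hsymm : ∀ (h : Equiv.Perm ι), (∀ i, r (h i) = r i) → ∀ v, φ (v ∘ h) = φ v)
    (hW : ∀ w : κ → V, φ (w ∘ r) ∈ W) (v : ι → V) : φ v ∈ W := by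
  classical
  set A : ι → Finset ι := fun i => {j | r j = r i}
  set cnt : (ι → ι) → ι → ℕ := fun f j => (Finset.univ.filter fun i => f i = j).card
  have key := sum_coeff_mem W (Fintype.piFinset A) cnt (fun f => φ (v ∘ f)) (1 : MvPolynomial ι K)
    one_ne_zero (fun t _ => by
      have h1 := hW fun k => ∑ j with r j = k, t j • v j
      have h2 : φ ((fun k => ∑ j with r j = k, t j • v j) ∘ r) =
          φ (fun i => ∑ j ∈ A i, t j • v j) := rfl
      rw [h2, MultilinearMap.map_sum_finset] at h1
      convert h1 using 2 with f hf
      rw [MultilinearMap.map_smul_univ φ (fun i => t (f i))]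
      congr 1
      rw [← Finset.prod_fiberwise Finset.univ f fun i => t (f i)]
      refine Finset.prod_congr rfl fun j _ => ?_
      rw [← Finset.prod_const]
      refine Finset.prod_congr rfl fun i hi => ?_
      rw [(Finset.mem_filter.mp hi).2]) (fun _ => 1)
  rw [Finset.sum_congr rfl (g := fun _ => φ v), Finset.sum_const, ← Nat.cast_smul_eq_nsmul K] at key
  · refine (W.smul_mem_iff ?_).mp key
    rw [Nat.cast_ne_zero, Finset.card_ne_zero]
    refine ⟨id, ?_⟩
    simp only [A, cnt, Finset.mem_filter, Fintype.mem_piFinset, id_eq, Finset.mem_univ,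
      true_and, implies_true]
    funext x
    exact Finset.card_eq_one.mpr ⟨x, by ext; simp⟩
  · intro f hf
    obtain ⟨hfA, hf1⟩ := Finset.mem_filter.mp hf
    have hinj : Function.Injective f := by
      intro i j hij
      have := congrFun hf1 (f j)
      obtain ⟨a, ha⟩ := Finset.card_eq_one.mp this
      have hi : i ∈ ({a} : Finset ι) := by rw [← ha]; simpa using hij
      have hj : j ∈ ({a} : Finset ι) := by rw [← ha]; simp
      rw [Finset.mem_singleton.mp hi, Finset.mem_singleton.mp hj]
    have hb := Finite.injective_iff_bijective.mp hinj
    refine hsymm (Equiv.ofBijective f hb) (fun i => ?_) v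
    simpa [A] using Fintype.mem_piFinset.mp hfA i

/-- `GL(V)` is Zariski dense in `End(V)`: `t • 1 + f` is invertible for all `t` but the roots of a
characteristic polynomial, and the value at `f` is the constant coefficient in `t`. -/
theorem MultilinearMap.mem_of_forall_unit_mem {ι V E : Type*} [Fintype ι] [AddCommGroup V]
    [Module K V] [FiniteDimensional K V] [AddCommGroup E] [Module K E]
    (F : MultilinearMap K (fun _ : ι => V →ₗ[K] V) E) (W : Submodule K E)
    (hW : ∀ g : LinearMap.GeneralLinearGroup K V, F (fun _ => (g : V →ₗ[K] V)) ∈ W)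
    (f : V →ₗ[K] V) : F (fun _ => f) ∈ W := by
  classical
  set p := (-f).charpoly
  have hp (t : K) : p.eval t = LinearMap.det (t • (1 : V →ₗ[K] V) + f) := by
    rw [LinearMap.eval_charpoly, sub_neg_eq_add, Algebra.algebraMap_eq_smul_one]
  set D : MvPolynomial Unit K := Polynomial.aeval (MvPolynomial.X ()) p
  have hDe (t : Unit → K) : MvPolynomial.eval t D = p.eval (t ()) := by
    simp only [D]
    rw [← MvPolynomial.coe_aeval_eq_eval, RingHom.coe_coe, ← Polynomial.aeval_algHom_apply]
    simp [Polynomial.aeval_def, Polynomial.eval₂_eq_eval_map]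
  have hD : D ≠ 0 := by
    intro h0
    refine (LinearMap.charpoly_monic (-f)).ne_zero (Polynomial.funext fun t => ?_)
    rw [← hDe fun _ => t, h0]
    simp
  have key := sum_coeff_mem W (Finset.univ : Finset (ι → Bool))
    (fun r (_ : Unit) => (Finset.univ.filter fun i => r i = true).card)
    (fun r => F fun i => bif r i then 1 else f) D hD (fun t ht => by
      have hu : IsUnit (LinearMap.det (t () • (1 : V →ₗ[K] V) + f)) := by
        rw [← hp, ← hDe]
        exact isUnit_iff_ne_zero.mpr ht
      obtain ⟨g, hg⟩ := (LinearMap.isUnit_iff_isUnit_det _).mpr hu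
      have h1 := hW g
      have h2 : F (fun _ => t () • (1 : V →ₗ[K] V) + f) =
          F fun _ => ∑ b : Bool, (bif b then t () else 1) • (bif b then 1 else f) := by
        simp
      rw [hg, h2, MultilinearMap.map_sum] at h1
      convert h1 using 2 with r _
      rw [MultilinearMap.map_smul_univ F (fun i => bif r i then t () else 1)]
      congr 1
      simp [Finset.prod_ite, Bool.cond_eq_ite]) (fun _ => 0)
  rw [Finset.sum_eq_single (fun _ => false)] at key
  · simpa using key
  · intro r hr hne
    exfalso
    apply hne
    have := congrFun (Finset.mem_filter.mp hr).2 ()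
    simp only [Finset.card_eq_zero, Finset.filter_eq_empty_iff] at this
    funext i
    simpa using this (Finset.mem_univ i)
  · intro h
    exfalso
    apply h
    simp

end Density

/-! ### Complete reducibility of tensor powers -/

section TensorRep

variable {K : Type*} [Field K] {V : Type*} [AddCommGroup V] [Module K V]

variable (K V) in
/-- The diagonal action of `GL(V)` on a tensor power of `V`. -/
def tensorRep (ι : Type*) :
    Representation K (LinearMap.GeneralLinearGroup K V) (⨂[K] _ : ι, V) where
  toFun g := PiTensorProduct.map fun _ => (g : V →ₗ[K] V)
  map_one' := PiTensorProduct.map_one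
  map_mul' _ _ := PiTensorProduct.map_mul _ _

theorem tensorRep_tprod {ι : Type*} (g : LinearMap.GeneralLinearGroup K V) (v : ι → V) :
    tensorRep K V ι g (PiTensorProduct.tprod K v) =
      PiTensorProduct.tprod K fun i => (g : V →ₗ[K] V) (v i) :=
  PiTensorProduct.map_tprod _ _

variable (K V) in
/-- The action of the symmetric group on a tensor power of `V` by permutation of the factors. -/
def permRep (ι : Type*) : Representation K (Equiv.Perm ι) (⨂[K] _ : ι, V) where
  toFun s := (PiTensorProduct.reindex K (fun _ : ι => V) s).toLinearMap
  map_one' := by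
    rw [Equiv.Perm.one_def, PiTensorProduct.reindex_refl]
    rfl
  map_mul' s t := by
    ext v
    simp only [LinearMap.compMultilinearMap_apply, LinearEquiv.coe_coe, Module.End.mul_apply,
      PiTensorProduct.reindex_tprod]
    rfl

theorem permRep_tprod {ι : Type*} (s : Equiv.Perm ι) (v : ι → V) :
    permRep K V ι s (PiTensorProduct.tprod K v) =
      PiTensorProduct.tprod K fun i => v (s.symm i) :=
  PiTensorProduct.reindex_tprod _ _

/-- The endomorphisms of a tensor power are spanned by the tensor products of endomorphisms. -/
theorem span_range_piTensorProduct_map [FiniteDimensional K V] (ι : Type*) [Finite ι] :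
    Submodule.span K (Set.range fun F : ι → V →ₗ[K] V => PiTensorProduct.map (R := K) F) = ⊤ := by
  classical
  have := Fintype.ofFinite ι
  set b := Module.finBasis K V
  set B := Basis.piTensorProduct fun _ : ι => b
  rw [eq_top_iff]
  rintro ψ -
  have h : ψ = ∑ f, ∑ g, B.repr (ψ (B f)) g •
      PiTensorProduct.map fun i => (b.coord (f i)).smulRight (b (g i)) := by
    refine B.ext fun h => ?_
    have h1 (f g : ι → Fin (Module.finrank K V)) :
        PiTensorProduct.map (fun i => (b.coord (f i)).smulRight (b (g i))) (B h) =
          if f = h then B g else 0 := by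
      simp only [B, Basis.piTensorProduct_apply, PiTensorProduct.map_tprod,
        LinearMap.smulRight_apply, Module.Basis.coord_apply]
      rw [MultilinearMap.map_smul_univ]
      by_cases hfh : f = h
      · simp [hfh]
      · obtain ⟨i, hi⟩ := Function.ne_iff.mp hfh
        rw [Finset.prod_eq_zero (Finset.mem_univ i), zero_smul, if_neg hfh]
        rw [Module.Basis.repr_self, Finsupp.single_eq_of_ne hi]
    simp only [LinearMap.sum_apply, LinearMap.smul_apply, h1, smul_ite, smul_zero]
    rw [Finset.sum_comm]
    simp [B.sum_repr]
  rw [h]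
  exact Submodule.sum_mem _ fun f _ => Submodule.sum_mem _ fun g _ =>
    Submodule.smul_mem _ _ (Submodule.subset_span ⟨_, rfl⟩)

/-- An endomorphism of a tensor power commuting with the permutations of the factors is a linear
combination of operators of `GL(V)`: it is an average over the permutations of tensor products of
endomorphisms, so polarization and the density of `GL(V)` apply. -/
theorem mem_span_range_tensorRep [CharZero K] [FiniteDimensional K V] {ι : Type*} [Finite ι]
    (φ : Module.End K (⨂[K] _ : ι, V)) (hφ : ∀ s, permRep K V ι s ∘ₗ φ = φ ∘ₗ permRep K V ι s) :
    φ ∈ Submodule.span K (Set.range (tensorRep K V ι)) := by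
  classical
  have := Fintype.ofFinite ι
  set W := Submodule.span K (Set.range (tensorRep K V ι))
  set Φ : MultilinearMap K (fun _ : ι => V →ₗ[K] V) (Module.End K (⨂[K] _ : ι, V)) :=
    ∑ s : Equiv.Perm ι, (PiTensorProduct.mapMultilinear K (fun _ : ι => V)
      (fun _ : ι => V)).domDomCongr s
  have hΦ (F) : Φ F = ∑ s : Equiv.Perm ι, PiTensorProduct.map fun i => F (s i) := by
    simp only [Φ, sum_apply]
    rfl
  have hΦW (F) : Φ F ∈ W := by
    refine MultilinearMap.mem_of_forall_comp_mem (fun _ => ()) Φ W (fun h _ v => ?_) (fun w => ?_) F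
    · rw [hΦ, hΦ]
      exact Fintype.sum_equiv (Equiv.mulLeft h) _ _ fun s => rfl
    · refine MultilinearMap.mem_of_forall_unit_mem Φ W (fun g => ?_) (w ())
      rw [hΦ]
      exact Submodule.sum_mem _ fun s _ => Submodule.subset_span ⟨g, rfl⟩
  set Av : Module.End K (⨂[K] _ : ι, V) →ₗ[K] Module.End K (⨂[K] _ : ι, V) :=
    ∑ s : Equiv.Perm ι, (LinearMap.mulLeft K (permRep K V ι s⁻¹)) ∘ₗ
      (LinearMap.mulRight K (permRep K V ι s))
  have hAv (ψ) : Av ψ = ∑ s : Equiv.Perm ι, permRep K V ι s⁻¹ * (ψ * permRep K V ι s) := by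
    simp [Av]
  have hAvW : ⊤ ≤ W.comap Av := by
    rw [← span_range_piTensorProduct_map ι, Submodule.span_le]
    rintro _ ⟨F, rfl⟩
    change Av (PiTensorProduct.map F) ∈ W
    convert hΦW F using 1
    rw [hAv, hΦ]
    refine Finset.sum_congr rfl fun s _ => ?_
    refine PiTensorProduct.ext (MultilinearMap.ext fun v => ?_)
    simp only [LinearMap.compMultilinearMap_apply, Module.End.mul_apply, permRep_tprod,
      PiTensorProduct.map_tprod]
    congr 1
    funext i
    exact congrArg (fun j => F (s i) (v j)) (s.symm_apply_apply i)
  have h1 : Av φ = (Fintype.card (Equiv.Perm ι) : K) • φ := by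
    rw [hAv, Finset.sum_congr rfl (g := fun _ => φ), Finset.sum_const, Nat.cast_smul_eq_nsmul,
      Finset.card_univ]
    intro s _
    have : φ * permRep K V ι s = permRep K V ι s * φ := (hφ s).symm
    rw [this, ← mul_assoc, ← map_mul]
    simp
  have h2 : Av φ ∈ W := hAvW Submodule.mem_top
  rw [h1] at h2
  exact (W.smul_mem_iff (Nat.cast_ne_zero.mpr Fintype.card_ne_zero)).mp h2

theorem apply_mem_of_permRep_comm [CharZero K] [FiniteDimensional K V] {ι : Type*} [Finite ι]
    (S : Subrepresentation (tensorRep K V ι)) (φ : Module.End K (⨂[K] _ : ι, V))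
    (hφ : ∀ s, permRep K V ι s ∘ₗ φ = φ ∘ₗ permRep K V ι s) {x : ⨂[K] _ : ι, V}
    (hx : x ∈ S.toSubmodule) : φ x ∈ S.toSubmodule := by
  have hle : Submodule.span K (Set.range (tensorRep K V ι)) ≤
      S.toSubmodule.comap (LinearMap.applyₗ x) := by
    rw [Submodule.span_le]
    rintro _ ⟨g, rfl⟩
    exact S.apply_mem_toSubmodule g hx
  exact hle (mem_span_range_tensorRep φ hφ)

theorem isCompl_toSubmodule_iff {G E : Type*} [Monoid G] [AddCommGroup E] [Module K E]
    {ρ : Representation K G E} (S T : Subrepresentation ρ) :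
    IsCompl S.toSubmodule T.toSubmodule ↔ IsCompl S T := by
  rw [isCompl_iff, isCompl_iff, disjoint_iff, disjoint_iff, codisjoint_iff, codisjoint_iff,
    ← Subrepresentation.toSubmodule_inf, ← Subrepresentation.toSubmodule_sup,
    ← Subrepresentation.toSubmodule_injective.eq_iff,
    ← Subrepresentation.toSubmodule_injective.eq_iff]
  rfl

/-- The subrepresentations of a tensor power are its submodules over the centralizer of the symmetric
group, which is a semisimple ring as the group algebra of the symmetric group is. -/
theorem isSemisimple_tensorRep [CharZero K] [FiniteDimensional K V] (ι : Type*) [Finite ι] :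
    (tensorRep K V ι).IsSemisimpleRepresentation := by
  classical
  have := Fintype.ofFinite ι
  have : NeZero (Nat.card (Equiv.Perm ι) : K) := ⟨Nat.cast_ne_zero.mpr Nat.card_pos.ne'⟩
  have hfin : Module.Finite (MonoidAlgebra K (Equiv.Perm ι)) (permRep K V ι).asModule :=
    Module.Finite.of_restrictScalars_finite K _ _
  have hsemi : IsSemisimpleRing
      (Module.End (MonoidAlgebra K (Equiv.Perm ι)) (permRep K V ι).asModule) :=
    IsSemisimpleRing.moduleEnd _ _
  have hcompl : IsSemisimpleModule
      (Module.End (MonoidAlgebra K (Equiv.Perm ι)) (permRep K V ι).asModule)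
      (permRep K V ι).asModule := inferInstance
  refine ⟨fun S => ?_⟩
  set S' : Submodule (Module.End (MonoidAlgebra K (Equiv.Perm ι)) (permRep K V ι).asModule)
      (permRep K V ι).asModule :=
    { carrier := (S.toSubmodule : Set (⨂[K] _ : ι, V))
      add_mem' := S.toSubmodule.add_mem
      zero_mem' := S.toSubmodule.zero_mem
      smul_mem' := fun f x hx => by
        set φ := (Representation.IntertwiningMap.equivLinearMapAsModule _ _).symm f
        exact apply_mem_of_permRep_comm S φ.toLinearMap (fun s => (φ.isIntertwining' s).symm) hx }
  obtain ⟨Q, hQ⟩ := hcompl.exists_isCompl S'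
  let T : Subrepresentation (tensorRep K V ι) :=
    { toSubmodule :=
        { carrier := (Q : Set (permRep K V ι).asModule)
          add_mem' := Q.add_mem
          zero_mem' := Q.zero_mem
          smul_mem' := fun c x hx => by
            exact Q.smul_mem (Representation.IntertwiningMap.equivLinearMapAsModule _ _
              (c • Representation.IntertwiningMap.id (permRep K V ι))) hx }
      apply_mem_toSubmodule := fun g x hx => by
        refine Q.smul_mem (Representation.IntertwiningMap.equivLinearMapAsModule _ _
          (⟨tensorRep K V ι g, fun s => ?_⟩ : (permRep K V ι).IntertwiningMap (permRep K V ι))) hx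
        exact PiTensorProduct.map_comp_reindex_eq (fun _ : ι => (g : V →ₗ[K] V)) s }
  refine ⟨T, (isCompl_toSubmodule_iff S T).mp ?_⟩
  rw [isCompl_iff, Submodule.disjoint_def, codisjoint_iff, Submodule.eq_top_iff'] at hQ ⊢
  refine ⟨hQ.1, fun x => ?_⟩
  obtain ⟨y, hy, z, hz, h⟩ := Submodule.mem_sup.mp (hQ.2 x)
  exact Submodule.mem_sup.mpr ⟨y, hy, z, hz, h⟩

end TensorRep

section Quotients

variable {K G E F : Type*} [Field K] [Monoid G] [AddCommGroup E] [Module K E] [AddCommGroup F]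
  [Module K F] {ρ : Representation K G E} {σ : Representation K G F}

/-- Complete reducibility passes to homomorphic images. -/
theorem isSemisimple_of_surjective (hρ : ρ.IsSemisimpleRepresentation)
    (π : ρ.IntertwiningMap σ) (hπ : Function.Surjective π) :
    σ.IsSemisimpleRepresentation := by
  rw [Representation.isSemisimpleRepresentation_iff_isSemisimpleModule_asModule] at hρ ⊢
  exact IsSemisimpleModule.of_surjective
    (Representation.IntertwiningMap.equivLinearMapAsModule _ _ π) hπ

end Quotients

/-! ### Weights and highest weight vectors -/

section Weights

open Module

variable {K : Type*} [Field K] {V : Type*} [AddCommGroup V] [Module K V] {m : ℕ}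

/-- The element of `GL(V)` scaling the basis vector `e i` by the unit `t i`. -/
def torusElt (e : Basis (Fin m) K V) (t : Fin m → Kˣ) : LinearMap.GeneralLinearGroup K V where
  val := e.constr K fun i => (t i : K) • e i
  inv := e.constr K fun i => ((t i)⁻¹ : Kˣ).val • e i
  val_inv := e.ext fun i => by simp [smul_smul]
  inv_val := e.ext fun i => by simp [smul_smul]

theorem torusElt_apply_basis (e : Basis (Fin m) K V) (t : Fin m → Kˣ) (i : Fin m) :
    (torusElt e t : V →ₗ[K] V) (e i) = (t i : K) • e i :=
  e.constr_basis K _ i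

/-- The element of `GL(V)` permuting the basis `e`. -/
def permElt (e : Basis (Fin m) K V) (s : Equiv.Perm (Fin m)) :
    LinearMap.GeneralLinearGroup K V where
  val := e.constr K fun i => e (s i)
  inv := e.constr K fun i => e (s⁻¹ i)
  val_inv := e.ext fun i => by simp
  inv_val := e.ext fun i => by simp

theorem permElt_apply_basis (e : Basis (Fin m) K V) (s : Equiv.Perm (Fin m)) (i : Fin m) :
    (permElt e s : V →ₗ[K] V) (e i) = e (s i) :=
  e.constr_basis K _ i

/-- `g` preserves the flag of the subspaces spanned by `e 0, ..., e j`. -/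
def IsUpperTriangular (e : Basis (Fin m) K V) (g : V →ₗ[K] V) : Prop :=
  ∀ i j, j < i → e.repr (g (e j)) i = 0

/-- The value at `g` of the character `lam` of the group of upper triangular elements: the product
of the `lam i`-th powers of the diagonal entries. -/
def diagChar (e : Basis (Fin m) K V) (lam : Fin m → ℕ) (g : V →ₗ[K] V) : K :=
  ∏ i, e.repr (g (e i)) i ^ lam i

theorem isUpperTriangular_torusElt (e : Basis (Fin m) K V) (t : Fin m → Kˣ) :
    IsUpperTriangular e (torusElt e t : V →ₗ[K] V) := fun i j hij => by
  rw [torusElt_apply_basis, map_smul, Finsupp.smul_apply, Basis.repr_self,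
    Finsupp.single_eq_of_ne hij.ne', smul_zero]

theorem diagChar_torusElt (e : Basis (Fin m) K V) (lam : Fin m → ℕ) (t : Fin m → Kˣ) :
    diagChar e lam (torusElt e t : V →ₗ[K] V) = ∏ i, (t i : K) ^ lam i := by
  simp [diagChar, torusElt_apply_basis]

/-- `u` is a nonzero vector on which the upper triangular elements of `GL(V)` act through the
character `lam`. -/
structure IsHighestWeightVector {E : Type*} [AddCommGroup E] [Module K E]
    (e : Basis (Fin m) K V) (σ : Representation K (LinearMap.GeneralLinearGroup K V) E)
    (lam : Fin m → ℕ) (u : E) : Prop where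
  ne_zero : u ≠ 0
  apply_eq : ∀ g : LinearMap.GeneralLinearGroup K V, IsUpperTriangular e (g : V →ₗ[K] V) →
    σ g u = diagChar e lam (g : V →ₗ[K] V) • u

theorem IsHighestWeightVector.map {E F : Type*} [AddCommGroup E] [Module K E] [AddCommGroup F]
    [Module K F] {e : Basis (Fin m) K V}
    {σ : Representation K (LinearMap.GeneralLinearGroup K V) E}
    {τ : Representation K (LinearMap.GeneralLinearGroup K V) F} {lam : Fin m → ℕ} {u : E}
    (hu : IsHighestWeightVector e σ lam u) (φ : σ.IntertwiningMap τ) (hφ : φ u ≠ 0) :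
    IsHighestWeightVector e τ lam (φ u) :=
  ⟨hφ, fun g hg => by rw [← φ.isIntertwining, hu.apply_eq g hg, map_smul]⟩

/-- A linear function on weights which is strictly monotone in the dominance order. -/
def height (lam : Fin m → ℕ) : ℕ := ∑ i, lam i * (m - i)

variable {ι : Type*} [Fintype ι]

/-- The weight of the basis tensor indexed by `f`: how often each basis vector occurs. -/
def content (f : ι → Fin m) : Fin m → ℕ := fun k => (Finset.univ.filter fun i => f i = k).card

theorem prod_pow_content {M : Type*} [CommMonoid M] (f : ι → Fin m) (t : Fin m → M) :
    ∏ k, t k ^ content f k = ∏ i, t (f i) := by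
  rw [← Finset.prod_fiberwise Finset.univ f fun i => t (f i)]
  refine Finset.prod_congr rfl fun k _ => ?_
  rw [content, ← Finset.prod_const]
  refine Finset.prod_congr rfl fun i hi => ?_
  rw [(Finset.mem_filter.mp hi).2]

theorem height_content (f : ι → Fin m) : height (content f) = ∑ i, (m - f i) := by
  rw [height, ← Finset.sum_fiberwise Finset.univ f fun i => m - (f i : ℕ)]
  refine Finset.sum_congr rfl fun k _ => ?_
  rw [content, ← smul_eq_mul, ← Finset.sum_const]
  refine Finset.sum_congr rfl fun i hi => ?_
  rw [(Finset.mem_filter.mp hi).2]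

theorem content_perm_comp (f : ι → Fin m) (s : Equiv.Perm (Fin m)) :
    content (s ∘ f) = content f ∘ s.symm := by
  funext k
  simp only [content, Function.comp_apply]
  congr 1
  ext i
  simp [Equiv.eq_symm_apply]

variable (ι) in
/-- The basis of a tensor power of `V` formed by the pure tensors in the basis vectors. -/
abbrev tensorBasis (e : Basis (Fin m) K V) : Basis (ι → Fin m) K (⨂[K] _ : ι, V) :=
  Basis.piTensorProduct fun _ => e

theorem tensorRep_torusElt (e : Basis (Fin m) K V) (t : Fin m → Kˣ) (f : ι → Fin m) :
    tensorRep K V ι (torusElt e t) (tensorBasis ι e f) =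
      (∏ k, (t k : K) ^ content f k) • tensorBasis ι e f := by
  rw [Basis.piTensorProduct_apply, tensorRep_tprod, prod_pow_content,
    ← MultilinearMap.map_smul_univ]
  simp only [torusElt_apply_basis]

theorem tensorRep_permElt (e : Basis (Fin m) K V) (s : Equiv.Perm (Fin m)) (f : ι → Fin m) :
    tensorRep K V ι (permElt e s) (tensorBasis ι e f) = tensorBasis ι e (s ∘ f) := by
  rw [Basis.piTensorProduct_apply, tensorRep_tprod, Basis.piTensorProduct_apply]
  simp only [permElt_apply_basis, Function.comp_apply]

open Classical in
/-- The projection of a tensor power of `V` onto the space of vectors of weight `μ`. -/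
def weightProj (e : Basis (Fin m) K V) (μ : Fin m → ℕ) :
    (⨂[K] _ : ι, V) →ₗ[K] ⨂[K] _ : ι, V :=
  ∑ f with content f = μ, ((tensorBasis ι e).coord f).smulRight (tensorBasis ι e f)

open Classical in
theorem weightProj_apply (e : Basis (Fin m) K V) (μ : Fin m → ℕ) (x : ⨂[K] _ : ι, V) :
    weightProj e μ x =
      ∑ f with content f = μ, (tensorBasis ι e).repr x f • tensorBasis ι e f := by
  simp [weightProj]

open Classical in
theorem weightProj_basis (e : Basis (Fin m) K V) (μ : Fin m → ℕ) (f : ι → Fin m) :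
    weightProj e μ (tensorBasis ι e f) = if content f = μ then tensorBasis ι e f else 0 := by
  rw [weightProj_apply]
  split_ifs with h
  · rw [Finset.sum_eq_single f]
    · rw [Basis.repr_self, Finsupp.single_eq_same, one_smul]
    · intro g _ hg
      rw [Basis.repr_self, Finsupp.single_eq_of_ne hg, zero_smul]
    · intro hf
      exact (hf (by simp [h])).elim
  · refine Finset.sum_eq_zero fun g hg => ?_
    rw [Basis.repr_self, Finsupp.single_eq_of_ne, zero_smul]
    rintro rfl
    exact h (Finset.mem_filter.mp hg).2

variable (m ι) in
open Classical in
/-- The weights occurring in a tensor power of `V`. -/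
def tensorWeights : Finset (Fin m → ℕ) := Finset.univ.image (content : (ι → Fin m) → _)

theorem sum_weightProj (e : Basis (Fin m) K V) (x : ⨂[K] _ : ι, V) :
    ∑ μ ∈ tensorWeights m ι, weightProj e μ x = x := by
  classical
  simp only [weightProj_apply]
  rw [Finset.sum_fiberwise_of_maps_to, Basis.sum_repr]
  exact fun f _ => Finset.mem_image_of_mem _ (Finset.mem_univ f)

theorem mem_tensorWeights_of_weightProj_ne_zero (e : Basis (Fin m) K V) {μ : Fin m → ℕ}
    {x : ⨂[K] _ : ι, V} (h : weightProj e μ x ≠ 0) : μ ∈ tensorWeights m ι := by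
  classical
  rw [weightProj_apply] at h
  obtain ⟨f, hf, -⟩ := Finset.exists_ne_zero_of_sum_ne_zero h
  exact Finset.mem_image.mpr ⟨f, Finset.mem_univ f, (Finset.mem_filter.mp hf).2⟩

/-- A subspace stable under the torus contains the weight components of its elements. -/
theorem map_weightProj_mem [CharZero K] {E : Type*} [AddCommGroup E] [Module K E]
    (e : Basis (Fin m) K V) (π : (⨂[K] _ : ι, V) →ₗ[K] E) (W : Submodule K E)
    {x : ⨂[K] _ : ι, V} (h : ∀ t : Fin m → Kˣ, π (tensorRep K V ι (torusElt e t) x) ∈ W)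
    (ν : Fin m → ℕ) : π (weightProj e ν x) ∈ W := by
  classical
  have key := sum_coeff_mem W (Finset.univ : Finset (ι → Fin m)) content
    (fun f => (tensorBasis ι e).repr x f • π (tensorBasis ι e f))
    (∏ i, MvPolynomial.X i : MvPolynomial (Fin m) K)
    (Finset.prod_ne_zero_iff.mpr fun i _ => MvPolynomial.X_ne_zero i) (fun t ht => by
      simp only [map_prod, MvPolynomial.eval_X, Finset.prod_ne_zero_iff] at ht
      have h1 := h fun i => Units.mk0 (t i) (ht i (Finset.mem_univ i))
      rw [← (tensorBasis ι e).sum_repr x, map_sum, map_sum] at h1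
      convert h1 using 2 with f _
      rw [map_smul, map_smul, tensorRep_torusElt, map_smul, smul_comm]
      rfl) ν
  rw [weightProj_apply, map_sum]
  simpa only [map_smul] using key

/-- The span of the basis tensors whose weight has height greater than `k`. -/
def aboveHeight (e : Basis (Fin m) K V) (k : ℕ) : Submodule K (⨂[K] _ : ι, V) :=
  Submodule.span K (tensorBasis ι e '' {f | k < height (content f)})

theorem lt_height_of_weightProj_ne_zero (e : Basis (Fin m) K V) {k : ℕ} {ν : Fin m → ℕ}
    {z : ⨂[K] _ : ι, V} (hz : z ∈ aboveHeight e k) (h : weightProj e ν z ≠ 0) :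
    k < height ν := by
  classical
  by_contra hk
  refine h ?_
  have : aboveHeight (ι := ι) e k ≤ LinearMap.ker (weightProj e ν) := by
    rw [aboveHeight, Submodule.span_le]
    rintro _ ⟨f, hf, rfl⟩
    rw [SetLike.mem_coe, LinearMap.mem_ker, weightProj_basis, if_neg]
    rintro rfl
    exact hk hf
  exact this hz

/-- An upper triangular map acts on a basis tensor by a scalar up to terms of greater height. -/
theorem tensorRep_sub_smul_mem_aboveHeight (e : Basis (Fin m) K V)
    {g : LinearMap.GeneralLinearGroup K V} (hg : IsUpperTriangular e (g : V →ₗ[K] V))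
    (f : ι → Fin m) :
    tensorRep K V ι g (tensorBasis ι e f) -
      diagChar e (content f) (g : V →ₗ[K] V) • tensorBasis ι e f ∈
        aboveHeight e (height (content f)) := by
  classical
  rw [aboveHeight, Basis.mem_span_image]
  intro h hh
  have hrepr : (tensorBasis ι e).repr (tensorRep K V ι g (tensorBasis ι e f)) h =
      ∏ i, e.repr ((g : V →ₗ[K] V) (e (f i))) (h i) := by
    rw [Basis.piTensorProduct_apply, tensorRep_tprod, Basis.piTensorProduct_repr_tprod_apply]
  rw [SetLike.mem_coe, Finsupp.mem_support_iff, map_sub, map_smul, Finsupp.sub_apply,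
    Finsupp.smul_apply, hrepr, Basis.repr_self] at hh
  have hne : h ≠ f := by
    rintro rfl
    apply hh
    rw [Finsupp.single_eq_same, diagChar,
      prod_pow_content h fun i => e.repr ((g : V →ₗ[K] V) (e i)) i]
    simp
  rw [Finsupp.single_eq_of_ne hne, smul_zero, sub_zero] at hh
  have hle (i : ι) : h i ≤ f i := by
    by_contra hlt
    exact hh (Finset.prod_eq_zero (Finset.mem_univ i) (hg _ _ (not_le.mp hlt)))
  obtain ⟨i, hi⟩ := Function.ne_iff.mp hne
  rw [Set.mem_ofPred_eq, height_content, height_content]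
  refine Finset.sum_lt_sum (fun j _ => ?_) ⟨i, Finset.mem_univ i, ?_⟩
  · have := hle j
    omega
  · have := lt_of_le_of_ne (hle i) hi
    have := (f i).isLt
    omega

theorem tensorRep_weightProj_sub_smul_mem_aboveHeight (e : Basis (Fin m) K V)
    {g : LinearMap.GeneralLinearGroup K V} (hg : IsUpperTriangular e (g : V →ₗ[K] V))
    (μ : Fin m → ℕ) (x : ⨂[K] _ : ι, V) :
    tensorRep K V ι g (weightProj e μ x) - diagChar e μ (g : V →ₗ[K] V) • weightProj e μ x ∈
      aboveHeight e (height μ) := by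
  classical
  rw [weightProj_apply, map_sum, Finset.smul_sum, ← Finset.sum_sub_distrib]
  refine Submodule.sum_mem _ fun f hf => ?_
  obtain rfl := (Finset.mem_filter.mp hf).2
  rw [map_smul, smul_comm, ← smul_sub]
  exact Submodule.smul_mem _ _ (tensorRep_sub_smul_mem_aboveHeight e hg f)

theorem height_comp_swap_le_imp {μ : Fin m → ℕ} {i j : Fin m} (hij : i < j)
    (h : height (μ ∘ Equiv.swap i j) ≤ height μ) : μ j ≤ μ i := by
  by_contra hlt
  rw [not_le] at hlt
  refine absurd h (not_le.mpr ?_)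
  have hj : j ∈ Finset.univ.erase i := Finset.mem_erase.mpr ⟨hij.ne', Finset.mem_univ j⟩
  simp only [height, Function.comp_apply]
  rw [← Finset.add_sum_erase _ _ (Finset.mem_univ i), ← Finset.add_sum_erase _ _ hj,
    ← Finset.add_sum_erase _ (fun k => μ (Equiv.swap i j k) * (m - k)) (Finset.mem_univ i),
    ← Finset.add_sum_erase _ (fun k => μ (Equiv.swap i j k) * (m - k)) hj,
    Equiv.swap_apply_left, Equiv.swap_apply_right]
  have hsum : ∑ k ∈ (Finset.univ.erase i).erase j, μ (Equiv.swap i j k) * (m - (k : ℕ)) =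
      ∑ k ∈ (Finset.univ.erase i).erase j, μ k * (m - (k : ℕ)) := by
    refine Finset.sum_congr rfl fun k hk => ?_
    simp only [Finset.mem_erase] at hk
    rw [Equiv.swap_apply_of_ne_of_ne hk.2.1 hk.1]
  rw [hsum]
  have hlt' : (m - j : ℕ) < m - i := by
    have := j.isLt
    have : (i : ℕ) < j := hij
    omega
  obtain ⟨a, ha⟩ := Nat.exists_eq_add_of_lt hlt'
  obtain ⟨c, hc⟩ := Nat.exists_eq_add_of_lt hlt
  rw [ha, hc]
  ring_nf
  nlinarith

/-- A nonzero subrepresentation of a homomorphic image of a tensor power of `V` contains a highest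
weight vector of some dominant weight: any vector of a weight of maximal height will do. -/
theorem exists_isHighestWeightVector [CharZero K] {E : Type*} [AddCommGroup E] [Module K E]
    (e : Basis (Fin m) K V) {σ : Representation K (LinearMap.GeneralLinearGroup K V) E}
    (π : (tensorRep K V ι).IntertwiningMap σ) (hπ : Function.Surjective π)
    (S : Subrepresentation σ) (hS : S ≠ ⊥) :
    ∃ lam u, Antitone lam ∧ u ∈ S ∧ IsHighestWeightVector e σ lam u := by
  classical
  have hcomp {x : ⨂[K] _ : ι, V} (hx : π x ∈ S) (ν : Fin m → ℕ) : π (weightProj e ν x) ∈ S :=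
    map_weightProj_mem e π.toLinearMap S.toSubmodule (fun t => by
      rw [Representation.IntertwiningMap.toLinearMap_apply, π.isIntertwining]
      exact S.apply_mem_toSubmodule _ hx) ν
  set T := (tensorWeights m ι).filter fun μ =>
    ∃ x : ⨂[K] _ : ι, V, π (weightProj e μ x) ∈ S ∧ π (weightProj e μ x) ≠ 0
  have hT {ν : Fin m → ℕ} {x : ⨂[K] _ : ι, V} (h1 : π (weightProj e ν x) ∈ S)
      (h2 : π (weightProj e ν x) ≠ 0) : ν ∈ T := by
    refine Finset.mem_filter.mpr ⟨mem_tensorWeights_of_weightProj_ne_zero e (x := x) ?_, x, h1, h2⟩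
    intro h0
    rw [h0, map_zero] at h2
    exact h2 rfl
  have hTne : T.Nonempty := by
    by_contra hemp
    refine hS (Subrepresentation.toSubmodule_injective ((Submodule.eq_bot_iff _).mpr ?_))
    intro y hy
    obtain ⟨x, rfl⟩ := hπ y
    rw [← sum_weightProj e x, map_sum]
    refine Finset.sum_eq_zero fun μ _ => ?_
    by_contra hne
    exact hemp ⟨μ, hT (hcomp hy μ) hne⟩
  obtain ⟨μ, hμT, hmax⟩ := Finset.exists_max_image T height hTne
  obtain ⟨x, hxS, hx0⟩ := (Finset.mem_filter.mp hμT).2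
  refine ⟨μ, π (weightProj e μ x), ?_, hxS, hx0, ?_⟩
  · intro i j hij
    rcases hij.eq_or_lt with rfl | hij
    · exact le_rfl
    refine height_comp_swap_le_imp hij (hmax _ ?_)
    have hp : tensorRep K V ι (permElt e (Equiv.swap i j)) (weightProj e μ x) =
        weightProj e (μ ∘ Equiv.swap i j)
          (tensorRep K V ι (permElt e (Equiv.swap i j)) (weightProj e μ x)) := by
      simp only [weightProj_apply e μ x, map_sum, map_smul, tensorRep_permElt, weightProj_basis]
      refine Finset.sum_congr rfl fun f hf => ?_
      rw [content_perm_comp, (Finset.mem_filter.mp hf).2, Equiv.symm_swap, if_pos rfl]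
    have h1 : π (tensorRep K V ι (permElt e (Equiv.swap i j)) (weightProj e μ x)) ∈ S := by
      rw [π.isIntertwining]
      exact S.apply_mem_toSubmodule _ hxS
    have h2 : π (tensorRep K V ι (permElt e (Equiv.swap i j)) (weightProj e μ x)) ≠ 0 := by
      rw [π.isIntertwining]
      intro h0
      refine hx0 ?_
      rw [← LinearMap.map_zero (σ (permElt e (Equiv.swap i j)))] at h0
      have := congrArg (σ (permElt e (Equiv.swap i j))⁻¹) h0
      simpa using this
    rw [hp] at h1 h2
    exact hT h1 h2
  · intro g hg
    set z := tensorRep K V ι g (weightProj e μ x) -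
      diagChar e μ (g : V →ₗ[K] V) • weightProj e μ x
    have hz : z ∈ aboveHeight e (height μ) :=
      tensorRep_weightProj_sub_smul_mem_aboveHeight e hg μ x
    have hπz : π z = σ g (π (weightProj e μ x)) -
        diagChar e μ (g : V →ₗ[K] V) • π (weightProj e μ x) := by
      rw [map_sub, map_smul, π.isIntertwining]
    have hzS : π z ∈ S := by
      rw [hπz]
      exact S.toSubmodule.sub_mem (S.apply_mem_toSubmodule _ hxS)
        (S.toSubmodule.smul_mem _ hxS)
    rw [← sub_eq_zero, ← hπz, ← sum_weightProj e z, map_sum]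
    refine Finset.sum_eq_zero fun ν _ => ?_
    by_contra hne
    have h1 := hmax ν (hT (hcomp hzS ν) hne)
    have h2 : height μ < height ν := lt_height_of_weightProj_ne_zero e hz fun h0 => by
      rw [h0, map_zero] at hne
      exact hne rfl
    omega

end Weights

section TorusEigenvectors

open Module

variable {K : Type*} [Field K] [CharZero K] {V : Type*} [AddCommGroup V] [Module K V] {m : ℕ}

/-- A vector on which the torus acts through `lam` is the image of a vector of weight `lam`. -/
theorem map_weightProj_eq_of_torus_eigenvector {ι : Type*} [Fintype ι] {E : Type*}
    [AddCommGroup E] [Module K E] (e : Basis (Fin m) K V) (π : (⨂[K] _ : ι, V) →ₗ[K] E)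
    (lam : Fin m → ℕ) (x : ⨂[K] _ : ι, V)
    (h : ∀ t : Fin m → Kˣ, π (tensorRep K V ι (torusElt e t) x) = (∏ i, (t i : K) ^ lam i) • π x) :
    π (weightProj e lam x) = π x := by
  classical
  have key := sum_coeff_mem (⊥ : Submodule K E) (Finset.univ : Finset (Option (ι → Fin m)))
    (fun a => a.elim lam content)
    (fun a => a.elim (-π x) fun f => (tensorBasis ι e).repr x f • π (tensorBasis ι e f))
    (∏ i, MvPolynomial.X i : MvPolynomial (Fin m) K)
    (Finset.prod_ne_zero_iff.mpr fun i _ => MvPolynomial.X_ne_zero i) (fun t ht => by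
      simp only [map_prod, MvPolynomial.eval_X, Finset.prod_ne_zero_iff] at ht
      have h1 := h fun i => Units.mk0 (t i) (ht i (Finset.mem_univ i))
      rw [Fintype.sum_option, Submodule.mem_bot]
      simp only [Option.elim_none, Option.elim_some, smul_neg]
      rw [neg_add_eq_zero]
      refine h1.symm.trans ?_
      nth_rw 1 [← (tensorBasis ι e).sum_repr x]
      rw [map_sum, map_sum]
      refine Finset.sum_congr rfl fun f _ => ?_
      rw [map_smul, map_smul, tensorRep_torusElt, map_smul, smul_comm]
      rfl) lam
  rw [Submodule.mem_bot, Finset.sum_filter, Fintype.sum_option] at key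
  simp only [Option.elim_none, Option.elim_some, if_true] at key
  rw [neg_add_eq_zero] at key
  rw [weightProj_apply, map_sum, key, Finset.sum_filter]
  simp only [map_smul]
  exact Finset.sum_congr rfl fun f _ => by congr

theorem IsHighestWeightVector.weight_unique {E : Type*} [AddCommGroup E] [Module K E]
    {e : Basis (Fin m) K V} {σ : Representation K (LinearMap.GeneralLinearGroup K V) E}
    {lam mu : Fin m → ℕ} {u : E} (h1 : IsHighestWeightVector e σ lam u)
    (h2 : IsHighestWeightVector e σ mu u) : lam = mu := by
  funext i
  set t : Fin m → Kˣ := Function.update 1 i (Units.mk0 2 two_ne_zero)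
  have ht (ν : Fin m → ℕ) : diagChar e ν (torusElt e t : V →ₗ[K] V) = ((2 ^ ν i : ℕ) : K) := by
    rw [diagChar_torusElt, Finset.prod_eq_single i]
    · simp [t]
    · intro j _ hj
      simp [t, Function.update_of_ne hj]
    · simp
  have h := (h1.apply_eq _ (isUpperTriangular_torusElt e t)).symm.trans
    (h2.apply_eq _ (isUpperTriangular_torusElt e t))
  rw [ht, ht] at h
  exact Nat.pow_right_injective le_rfl (Nat.cast_injective (smul_left_injective K h1.ne_zero h))

end TorusEigenvectors

/-! ### Weyl's construction -/

section Columns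

variable {m : ℕ}

/-- Among the subsets of `Fin m` of given cardinality, the initial segment has the strictly largest
sum of the `m - a`. -/
theorem Finset.sum_sub_lt_sum_sub_of_isLowerSet {A I : Finset (Fin m)} (hc : A.card = I.card)
    (hI : IsLowerSet (I : Set (Fin m))) (hne : A ≠ I) :
    ∑ a ∈ A, (m - (a : ℕ)) < ∑ i ∈ I, (m - (i : ℕ)) := by
  have hcard : (A \ I).card = (I \ A).card := Finset.card_sdiff_comm hc
  rw [← Finset.sum_inter_add_sum_sdiff A I, ← Finset.sum_inter_add_sum_sdiff I A,
    Finset.inter_comm I A]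
  refine Nat.add_lt_add_left ?_ _
  have hne' : (A \ I).Nonempty := by
    rw [Finset.sdiff_nonempty]
    exact fun h => hne (Finset.eq_of_subset_of_card_le h hc.ge)
  set b := (A \ I).min' hne'
  have hb := Finset.mem_sdiff.mp ((A \ I).min'_mem hne')
  calc ∑ a ∈ A \ I, (m - (a : ℕ)) ≤ (A \ I).card • (m - (b : ℕ)) :=
        Finset.sum_le_card_nsmul _ _ _ fun a ha => by
          have : (b : ℕ) ≤ a := (A \ I).min'_le a ha
          omega
    _ < (I \ A).card • (m - (b : ℕ) + 1) := by
        rw [← hcard, smul_eq_mul, smul_eq_mul]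
        exact Nat.mul_lt_mul_of_pos_left (Nat.lt_succ_self _) hne'.card_pos
    _ ≤ ∑ i ∈ I \ A, (m - (i : ℕ)) := Finset.card_nsmul_le_sum _ _ _ fun i hi => by
          have hlt : i < b := by
            by_contra hle
            exact hb.2 (hI (not_lt.mp hle) (Finset.mem_sdiff.mp hi).1)
          have h1 : (i : ℕ) < b := hlt
          have := b.isLt
          omega

variable {lam : Fin m → ℕ}

theorem content_fst (lam : Fin m → ℕ) : content (Sigma.fst : Cell lam → Fin m) = lam := by
  funext i
  rw [content, Finset.card_filter, Fintype.sum_sigma, Finset.sum_eq_single i]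
  · simp
  · intro j _ hj
    simp [hj]
  · simp

theorem content_comp_perm {ι : Type*} [Fintype ι] (f : ι → Fin m) (s : Equiv.Perm ι) :
    content (f ∘ s) = content f := by
  funext k
  refine Finset.card_bij (fun i _ => s i) ?_ ?_ ?_
  · simp
  · simp
  · intro j hj
    exact ⟨s.symm j, by simpa using hj, by simp⟩

/-- A filling of the cells which is injective on columns has at most the height of the filling by
row numbers, and if the heights agree then the fillings differ by a permutation within columns. -/
theorem exists_perm_of_injOn_columns (hlam : Antitone lam) (f : Cell lam → Fin m)
    (hf : ∀ c c' : Cell lam, (c.2 : ℕ) = c'.2 → f c = f c' → c = c')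
    (hh : height lam ≤ height (content f)) :
    height (content f) = height lam ∧
      ∃ q : Equiv.Perm (Cell lam), (∀ c, ((q c).2 : ℕ) = c.2) ∧ f = Sigma.fst ∘ q := by
  classical
  set col : Cell lam → ℕ := fun c => c.2
  set C : ℕ → Finset (Cell lam) := fun j => Finset.univ.filter fun c => col c = j
  have hinj (j : ℕ) : Set.InjOn f (C j) := fun c hc c' hc' h => by
    simp only [C, Finset.coe_filter, Finset.mem_univ, true_and] at hc hc'
    exact hf c c' (hc.trans hc'.symm) h
  have hinj' (j : ℕ) : Set.InjOn Sigma.fst (C j : Set (Cell lam)) := fun c hc c' hc' h => by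
    simp only [C, Finset.coe_filter, Finset.mem_univ, true_and] at hc hc'
    obtain ⟨i, k⟩ := c
    obtain ⟨i', k'⟩ := c'
    obtain rfl : i = i' := h
    obtain rfl : k = k' := Fin.ext (hc.trans hc'.symm)
    rfl
  have hlow (j : ℕ) : IsLowerSet (((C j).image Sigma.fst : Finset (Fin m)) : Set (Fin m)) := by
    intro a b hba ha
    simp only [C, Finset.coe_image, Finset.coe_filter, Finset.mem_univ, true_and] at ha ⊢
    obtain ⟨⟨i, k⟩, hk, rfl⟩ := ha
    exact ⟨⟨b, ⟨k, k.isLt.trans_le (hlam hba)⟩⟩, hk, rfl⟩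
  have hsum (g : Cell lam → Fin m) (hg : ∀ j, Set.InjOn g (C j)) : height (content g) =
      ∑ j ∈ Finset.univ.image col, ∑ a ∈ (C j).image g, (m - (a : ℕ)) := by
    rw [height_content, ← Finset.sum_fiberwise_of_maps_to (g := col)
      fun c _ => Finset.mem_image_of_mem _ (Finset.mem_univ c)]
    exact Finset.sum_congr rfl fun j _ => (Finset.sum_image (f := fun a : Fin m => m - (a : ℕ)) (hg j)).symm
  have hcard (j : ℕ) : ((C j).image f).card = ((C j).image Sigma.fst).card := by
    rw [Finset.card_image_of_injOn (hinj j), Finset.card_image_of_injOn (hinj' j)]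
  have hle (j : ℕ) : ∑ a ∈ (C j).image f, (m - (a : ℕ)) ≤
      ∑ a ∈ (C j).image Sigma.fst, (m - (a : ℕ)) := by
    by_cases h : (C j).image f = (C j).image Sigma.fst
    · rw [h]
    · exact (Finset.sum_sub_lt_sum_sub_of_isLowerSet (hcard j) (hlow j) h).le
  have hrow : height lam = ∑ j ∈ Finset.univ.image col,
      ∑ a ∈ (C j).image Sigma.fst, (m - (a : ℕ)) := by
    rw [← hsum _ hinj', content_fst]
  have himg (j : ℕ) (hj : j ∈ Finset.univ.image col) :
      (C j).image f = (C j).image Sigma.fst := by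
    by_contra hne
    refine absurd hh (not_le.mpr ?_)
    rw [hsum f hinj, hrow]
    exact Finset.sum_lt_sum (fun j _ => hle j)
      ⟨j, hj, Finset.sum_sub_lt_sum_sub_of_isLowerSet (hcard j) (hlow j) hne⟩
  refine ⟨le_antisymm ?_ hh, ?_⟩
  · rw [hsum f hinj, hrow]
    exact Finset.sum_le_sum fun j _ => hle j
  have hq (c : Cell lam) : ∃ c' : Cell lam, (c'.2 : ℕ) = c.2 ∧ c'.1 = f c := by
    have hc : f c ∈ (C (col c)).image f :=
      Finset.mem_image_of_mem _ (Finset.mem_filter.mpr ⟨Finset.mem_univ c, rfl⟩)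
    rw [himg _ (Finset.mem_image_of_mem _ (Finset.mem_univ c))] at hc
    obtain ⟨c', hc', h⟩ := Finset.mem_image.mp hc
    exact ⟨c', (Finset.mem_filter.mp hc').2, h⟩
  choose q hq1 hq2 using hq
  have hqinj : Function.Injective q := fun c c' h =>
    hf c c' ((hq1 c).symm.trans ((congrArg (fun d => (d.2 : ℕ)) h).trans (hq1 c')))
      ((hq2 c).symm.trans ((congrArg Sigma.fst h).trans (hq2 c')))
  exact ⟨Equiv.ofBijective q (Finite.injective_iff_bijective.mp hqinj), hq1,
    funext fun c => (hq2 c).symm⟩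

end Columns

section Weyl

open Module

variable {K : Type*} [Field K] {V : Type*} [AddCommGroup V] [Module K V] {m : ℕ}
  {lam : Fin m → ℕ}

theorem Equiv.Perm.apply_inv_apply {α : Type*} (q : Equiv.Perm α) (a : α) : q (q⁻¹ a) = a :=
  q.apply_symm_apply a

theorem rowSymmetrizer_permFactors (p : Equiv.Perm (Cell lam)) (hp : ∀ c, (p c).1 = c.1)
    (x : CellTensor K V lam) :
    rowSymmetrizer K V lam (permRep K V _ p x) = rowSymmetrizer K V lam x := by
  classical
  simp only [rowSymmetrizer, LinearMap.sum_apply]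
  refine Finset.sum_bij (fun s _ => s * p) ?_ ?_ ?_ ?_
  · intro s hs
    simp only [Finset.mem_filter, Finset.mem_univ, true_and, Equiv.Perm.mul_apply] at hs ⊢
    exact fun c => (hs _).trans (hp c)
  · intro s _ s' _ h
    exact mul_right_cancel h
  · intro s hs
    simp only [Finset.mem_filter, Finset.mem_univ, true_and] at hs
    refine ⟨s * p⁻¹, ?_, by simp⟩
    simp only [Finset.mem_filter, Finset.mem_univ, true_and, Equiv.Perm.mul_apply]
    intro c
    rw [hs, ← hp (p⁻¹ c), Equiv.Perm.apply_inv_apply]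
  · intro s _
    exact (LinearMap.congr_fun (map_mul (permRep K V (Cell lam)) s p) x).symm

theorem colAntisymmetrizer_permFactors (q : Equiv.Perm (Cell lam))
    (hq : ∀ c, ((q c).2 : ℕ) = c.2) (x : CellTensor K V lam) :
    colAntisymmetrizer K V lam (permRep K V _ q x) =
      ((Equiv.Perm.sign q : ℤ) : K) • colAntisymmetrizer K V lam x := by
  classical
  simp only [colAntisymmetrizer, LinearMap.sum_apply, LinearMap.smul_apply, Finset.smul_sum]
  refine Finset.sum_bij (fun s _ => s * q) ?_ ?_ ?_ ?_
  · intro s hs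
    simp only [Finset.mem_filter, Finset.mem_univ, true_and, Equiv.Perm.mul_apply] at hs ⊢
    exact fun c => (hs _).trans (hq c)
  · intro s _ s' _ h
    exact mul_right_cancel h
  · intro s hs
    simp only [Finset.mem_filter, Finset.mem_univ, true_and] at hs
    refine ⟨s * q⁻¹, ?_, by simp⟩
    simp only [Finset.mem_filter, Finset.mem_univ, true_and, Equiv.Perm.mul_apply]
    intro c
    rw [hs, ← hq (q⁻¹ c), Equiv.Perm.apply_inv_apply]
  · intro s _
    have h : permFactors K V (s * q) x = permFactors K V s (permRep K V _ q x) :=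
      LinearMap.congr_fun (map_mul (permRep K V (Cell lam)) s q) x
    rw [h, smul_smul]
    congr 1
    rw [Equiv.Perm.sign_mul]
    push_cast
    rw [mul_comm ((Equiv.Perm.sign s : ℤ) : K), ← mul_assoc, ← Int.cast_mul, ← Units.val_mul,
      Int.units_mul_self]
    simp

theorem colAntisymmetrizer_tprod_eq_zero [CharZero K] (v : Cell lam → V) {c c' : Cell lam}
    (hne : c ≠ c') (hcol : (c.2 : ℕ) = c'.2) (hv : v c = v c') :
    colAntisymmetrizer K V lam (PiTensorProduct.tprod K v) = 0 := by
  classical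
  have h := colAntisymmetrizer_permFactors (K := K) (V := V) (Equiv.swap c c') (fun d => by
    rcases eq_or_ne d c with rfl | h1
    · rw [Equiv.swap_apply_left, hcol]
    rcases eq_or_ne d c' with rfl | h2
    · rw [Equiv.swap_apply_right, hcol]
    rw [Equiv.swap_apply_of_ne_of_ne h1 h2]) (PiTensorProduct.tprod K v)
  have hs : (fun d => v ((Equiv.swap c c').symm d)) = v := by
    funext d
    rw [Equiv.symm_swap]
    rcases eq_or_ne d c with rfl | h1
    · rw [Equiv.swap_apply_left, hv]
    rcases eq_or_ne d c' with rfl | h2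
    · rw [Equiv.swap_apply_right, hv]
    rw [Equiv.swap_apply_of_ne_of_ne h1 h2]
  rw [permRep_tprod, hs, Equiv.Perm.sign_swap hne] at h
  rw [Units.val_neg, Units.val_one, Int.cast_neg, Int.cast_one, neg_one_smul, eq_neg_iff_add_eq_zero,
    ← two_smul K, smul_eq_zero] at h
  exact h.resolve_left two_ne_zero

/-- If `f` is not injective on some column, the antisymmetrizer kills its basis tensor; otherwise `f`
is the filling by row numbers up to a permutation within the columns. -/
theorem colAntisymmetrizer_basis_mem_span [CharZero K] (e : Basis (Fin m) K V)
    (hlam : Antitone lam) (f : Cell lam → Fin m) (hf : height lam ≤ height (content f)) :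
    colAntisymmetrizer K V lam (tensorBasis _ e f) ∈
      K ∙ colAntisymmetrizer K V lam (tensorBasis _ e Sigma.fst) := by
  by_cases hinj : ∀ c c' : Cell lam, (c.2 : ℕ) = c'.2 → f c = f c' → c = c'
  · obtain ⟨-, q, hq, rfl⟩ := exists_perm_of_injOn_columns hlam f hinj hf
    have h : tensorBasis (Cell lam) e (Sigma.fst ∘ q) =
        permRep K V _ q⁻¹ (tensorBasis (Cell lam) e Sigma.fst) := by
      rw [Basis.piTensorProduct_apply, Basis.piTensorProduct_apply, permRep_tprod]
      rfl
    rw [h, colAntisymmetrizer_permFactors]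
    · exact Submodule.smul_mem _ _ (Submodule.mem_span_singleton_self _)
    · intro c
      rw [← hq (q⁻¹ c), Equiv.Perm.apply_inv_apply]
  · push Not at hinj
    obtain ⟨c, c', hcol, hfc, hne⟩ := hinj
    rw [Basis.piTensorProduct_apply (fun _ => e) f,
      colAntisymmetrizer_tprod_eq_zero (fun c => e (f c)) hne hcol (by rw [hfc])]
    exact Submodule.zero_mem _

theorem colAntisymmetrizer_basis_eq_zero [CharZero K] (e : Basis (Fin m) K V)
    (hlam : Antitone lam) (f : Cell lam → Fin m) (hf : height lam < height (content f)) :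
    colAntisymmetrizer K V lam (tensorBasis _ e f) = 0 := by
  by_cases hinj : ∀ c c' : Cell lam, (c.2 : ℕ) = c'.2 → f c = f c' → c = c'
  · exact absurd (exists_perm_of_injOn_columns hlam f hinj hf.le).1 hf.ne'
  · push Not at hinj
    obtain ⟨c, c', hcol, hfc, hne⟩ := hinj
    rw [Basis.piTensorProduct_apply (fun _ => e) f,
      colAntisymmetrizer_tprod_eq_zero (fun c => e (f c)) hne hcol (by rw [hfc])]

theorem rowSymmetrizer_basis_fst [CharZero K] (e : Basis (Fin m) K V) :
    ∃ N : K, N ≠ 0 ∧ rowSymmetrizer K V lam (tensorBasis _ e Sigma.fst) =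
      N • tensorBasis _ e Sigma.fst := by
  classical
  refine ⟨((Finset.univ.filter fun s : Equiv.Perm (Cell lam) => ∀ c, (s c).1 = c.1).card : K),
    Nat.cast_ne_zero.mpr (Finset.card_ne_zero.mpr ⟨1, by simp⟩), ?_⟩
  rw [rowSymmetrizer, LinearMap.sum_apply, Nat.cast_smul_eq_nsmul, ← Finset.sum_const]
  refine Finset.sum_congr (by congr!) fun s hs => ?_
  have hs' := (Finset.mem_filter.mp hs).2
  change permRep K V _ s _ = _
  rw [Basis.piTensorProduct_apply, permRep_tprod]
  congr 1
  funext c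
  rw [← hs' (s.symm c), Equiv.apply_symm_apply]

theorem rowSymmetrizer_basis_mem_span (e : Basis (Fin m) K V) (f : Cell lam → Fin m) :
    rowSymmetrizer K V lam (tensorBasis _ e f) ∈
      Submodule.span K (tensorBasis _ e '' {h | content h = content f}) := by
  classical
  rw [rowSymmetrizer, LinearMap.sum_apply]
  refine Submodule.sum_mem _ fun s _ => Submodule.subset_span ⟨f ∘ s.symm, ?_, ?_⟩
  · exact content_comp_perm f s.symm
  · change _ = permRep K V _ s _
    rw [Basis.piTensorProduct_apply, Basis.piTensorProduct_apply, permRep_tprod]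
    rfl

theorem colAntisymmetrizer_basis_fst_ne_zero (e : Basis (Fin m) K V) :
    colAntisymmetrizer K V lam (tensorBasis _ e Sigma.fst) ≠ 0 := by
  classical
  intro h
  have h1 := congrArg (fun x => (tensorBasis (Cell lam) e).repr x Sigma.fst) h
  simp only [colAntisymmetrizer, LinearMap.sum_apply, LinearMap.smul_apply, map_sum, map_smul,
    Finsupp.coe_finsetSum, Finset.sum_apply, Finsupp.smul_apply, map_zero,
    Finsupp.zero_apply] at h1
  rw [Finset.sum_eq_single 1] at h1
  · rw [show permFactors K V (1 : Equiv.Perm (Cell lam)) = 1 from map_one (permRep K V _)] at h1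
    simp only [Equiv.Perm.sign_one, Units.val_one, Int.cast_one, Module.End.one_apply,
      Basis.repr_self, Finsupp.single_eq_same, smul_eq_mul, mul_one] at h1
    exact one_ne_zero h1
  · intro q hq hne
    have hq' := (Finset.mem_filter.mp hq).2
    have h2 : permFactors K V q (tensorBasis (Cell lam) e Sigma.fst) =
        tensorBasis (Cell lam) e (Sigma.fst ∘ q.symm) := by
      change permRep K V _ q _ = _
      rw [Basis.piTensorProduct_apply, Basis.piTensorProduct_apply, permRep_tprod]
      rfl
    rw [h2, Basis.repr_self, Finsupp.single_eq_of_ne, smul_zero]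
    intro heq
    refine hne (Equiv.ext fun c => ?_)
    have h3 : c.1 = (q c).1 := by simpa using (congrFun heq (q c)).symm
    obtain ⟨i, k⟩ := c
    have h4 := hq' ⟨i, k⟩
    generalize q ⟨i, k⟩ = c' at h3 h4
    obtain ⟨i', k'⟩ := c'
    obtain rfl : i = i' := h3
    obtain rfl : k' = k := Fin.ext h4
    rfl
  · intro h
    simp at h

variable (K V lam) in
/-- The Young symmetrizer as an intertwining map onto `V^lam`. -/
def schurProj : (tensorRep K V (Cell lam)).IntertwiningMap (schurRep lam (stdRep K V)) where
  toLinearMap := (colAntisymmetrizer K V lam ∘ₗ rowSymmetrizer K V lam).rangeRestrict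
  isIntertwining' g := by
    have hs (s : Equiv.Perm (Cell lam)) (x : CellTensor K V lam) :
        permFactors K V s (tensorRep K V (Cell lam) g x) =
          tensorRep K V (Cell lam) g (permFactors K V s x) :=
      (LinearMap.congr_fun (permFactors_comm (stdRep K V) g s) x).symm
    refine LinearMap.ext fun x => Subtype.ext ?_
    change colAntisymmetrizer K V lam (rowSymmetrizer K V lam (tensorRep K V (Cell lam) g _)) =
      tensorRep K V (Cell lam) g (colAntisymmetrizer K V lam (rowSymmetrizer K V lam _))
    simp only [rowSymmetrizer, colAntisymmetrizer, LinearMap.sum_apply,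
      LinearMap.smul_apply, map_sum, map_smul, hs]

theorem schurProj_coe (x : ⨂[K] _ : Cell lam, V) :
    (schurProj K V lam x : CellTensor K V lam) =
      colAntisymmetrizer K V lam (rowSymmetrizer K V lam x) := rfl

theorem schurProj_surjective : Function.Surjective (schurProj K V lam) :=
  LinearMap.surjective_rangeRestrict _

theorem isSemisimple_schurRep [CharZero K] [FiniteDimensional K V] :
    (schurRep lam (stdRep K V)).IsSemisimpleRepresentation :=
  isSemisimple_of_surjective (isSemisimple_tensorRep (Cell lam)) (schurProj K V lam)
    schurProj_surjective

variable (lam) in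
/-- The highest weight vector of `V^lam`: the image of the tensor whose factors in row `i` are all
equal to `e i`. -/
def schurVec (e : Basis (Fin m) K V) : schurSubmodule K V lam :=
  schurProj K V lam (tensorBasis _ e Sigma.fst)

theorem schurProj_basis_mem_span [CharZero K] (e : Basis (Fin m) K V)
    (hlam : Antitone lam) (f : Cell lam → Fin m) (hf : height lam ≤ height (content f)) :
    schurProj K V lam (tensorBasis _ e f) ∈ K ∙ schurVec lam e := by
  obtain ⟨N, hN, hrow⟩ := rowSymmetrizer_basis_fst (K := K) (V := V) (lam := lam) e
  have h1 : Submodule.span K (tensorBasis _ e '' {h | content h = content f}) ≤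
      (K ∙ colAntisymmetrizer K V lam (tensorBasis _ e Sigma.fst)).comap
        (colAntisymmetrizer K V lam) := by
    rw [Submodule.span_le]
    rintro _ ⟨h, hh, rfl⟩
    refine colAntisymmetrizer_basis_mem_span e hlam h ?_
    rw [show content h = content f from hh]
    exact hf
  obtain ⟨a, ha⟩ := Submodule.mem_span_singleton.mp (h1 (rowSymmetrizer_basis_mem_span e f))
  refine Submodule.mem_span_singleton.mpr ⟨a * N⁻¹, Subtype.ext ?_⟩
  rw [Submodule.coe_smul, schurVec, schurProj_coe, schurProj_coe, hrow, map_smul, smul_smul,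
    inv_mul_cancel_right₀ hN, ha]

theorem schurProj_eq_zero_of_mem_aboveHeight [CharZero K] (e : Basis (Fin m) K V)
    (hlam : Antitone lam) {x : ⨂[K] _ : Cell lam, V} (hx : x ∈ aboveHeight e (height lam)) :
    schurProj K V lam x = 0 := by
  have h : aboveHeight e (height lam) ≤
      LinearMap.ker (schurProj K V lam).toLinearMap := by
    rw [aboveHeight, Submodule.span_le]
    rintro _ ⟨f, hf, rfl⟩
    rw [SetLike.mem_coe, LinearMap.mem_ker]
    refine Subtype.ext ?_
    have h1 : Submodule.span K (tensorBasis _ e '' {h | content h = content f}) ≤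
        LinearMap.ker (colAntisymmetrizer K V lam) := by
      rw [Submodule.span_le]
      rintro _ ⟨h, hh, rfl⟩
      refine colAntisymmetrizer_basis_eq_zero e hlam h ?_
      rw [show content h = content f from hh]
      exact hf
    exact h1 (rowSymmetrizer_basis_mem_span e f)
  exact h hx

theorem schurProj_weightProj_mem_span [CharZero K] (e : Basis (Fin m) K V)
    (hlam : Antitone lam) {ν : Fin m → ℕ} (hν : height lam ≤ height ν)
    (x : ⨂[K] _ : Cell lam, V) :
    schurProj K V lam (weightProj e ν x) ∈ K ∙ schurVec lam e := by
  classical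
  rw [weightProj_apply, map_sum]
  refine Submodule.sum_mem _ fun f hf => ?_
  rw [map_smul]
  refine Submodule.smul_mem _ _ (schurProj_basis_mem_span e hlam f ?_)
  rw [(Finset.mem_filter.mp hf).2]
  exact hν

theorem isHighestWeightVector_schurVec [CharZero K] (e : Basis (Fin m) K V)
    (hlam : Antitone lam) :
    IsHighestWeightVector e (schurRep lam (stdRep K V)) lam (schurVec lam e) where
  ne_zero h := by
    obtain ⟨N, hN, hrow⟩ := rowSymmetrizer_basis_fst (K := K) (V := V) (lam := lam) e
    have h1 : (schurVec lam e : CellTensor K V lam) = 0 := by rw [h]; rfl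
    rw [schurVec, schurProj_coe, hrow, map_smul, smul_eq_zero] at h1
    exact h1.elim hN (colAntisymmetrizer_basis_fst_ne_zero e)
  apply_eq g hg := by
    have h1 := tensorRep_sub_smul_mem_aboveHeight e hg (Sigma.fst : Cell lam → Fin m)
    rw [content_fst] at h1
    have h2 := schurProj_eq_zero_of_mem_aboveHeight e hlam h1
    rw [map_sub, map_smul, (schurProj K V lam).isIntertwining, sub_eq_zero] at h2
    exact h2

/-- `V^lam` is generated by its highest weight vector. -/
theorem eq_top_of_schurVec_mem [CharZero K] [FiniteDimensional K V] (e : Basis (Fin m) K V)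
    (S : Subrepresentation (schurRep lam (stdRep K V))) (hS : schurVec lam e ∈ S) : S = ⊤ := by
  refine Subrepresentation.toSubmodule_injective ((Submodule.eq_top_iff').mpr fun y => ?_)
  obtain ⟨x, rfl⟩ := schurProj_surjective y
  suffices h : (⊤ : Submodule K (⨂[K] _ : Cell lam, V)) ≤
      S.toSubmodule.comap (schurProj K V lam).toLinearMap from h Submodule.mem_top
  rw [← PiTensorProduct.span_tprod_eq_top, Submodule.span_le]
  rintro _ ⟨v, rfl⟩
  refine MultilinearMap.mem_of_forall_comp_mem (Sigma.fst : Cell lam → Fin m)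
    ((schurProj K V lam).toLinearMap.compMultilinearMap (PiTensorProduct.tprod K)) S.toSubmodule
    (fun h hh v => ?_) (fun w => ?_) v
  · refine Subtype.ext ?_
    have h1 : PiTensorProduct.tprod K (v ∘ h) =
        permRep K V _ h⁻¹ (PiTensorProduct.tprod K v) := by
      rw [permRep_tprod]
      rfl
    change colAntisymmetrizer K V lam (rowSymmetrizer K V lam (PiTensorProduct.tprod K (v ∘ h))) =
      colAntisymmetrizer K V lam (rowSymmetrizer K V lam (PiTensorProduct.tprod K v))
    rw [h1, rowSymmetrizer_permFactors]
    intro c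
    rw [← hh (h⁻¹ c), Equiv.Perm.apply_inv_apply]
  · have h1 := MultilinearMap.mem_of_forall_unit_mem
      (((schurProj K V lam).toLinearMap ∘ₗ
        LinearMap.applyₗ (tensorBasis (Cell lam) e Sigma.fst)).compMultilinearMap
          (PiTensorProduct.mapMultilinear K (fun _ : Cell lam => V) (fun _ : Cell lam => V)))
      S.toSubmodule (fun g => ?_) (e.constr K w)
    · convert h1 using 1
      simp only [LinearMap.compMultilinearMap_apply, LinearMap.comp_apply,
        PiTensorProduct.mapMultilinear_apply, LinearMap.applyₗ_apply_apply,
        Basis.piTensorProduct_apply, PiTensorProduct.map_tprod, Basis.constr_basis]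
      rfl
    · have h2 := S.apply_mem_toSubmodule g hS
      rw [schurVec, ← (schurProj K V lam).isIntertwining] at h2
      exact h2

/-- The vectors of weight `lam` in `V^lam` form a line which generates it, and one of two complementary
subrepresentations contains this line. -/
theorem isIrreducible_schurRep [CharZero K] [FiniteDimensional K V] (e : Basis (Fin m) K V)
    (hlam : Antitone lam) : (schurRep lam (stdRep K V)).IsIrreducible := by
  have hHW := isHighestWeightVector_schurVec e hlam
  have hcomp (S : Subrepresentation (schurRep lam (stdRep K V))) {x : ⨂[K] _ : Cell lam, V}
      (hx : schurProj K V lam x ∈ S) : schurProj K V lam (weightProj e lam x) ∈ S :=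
    map_weightProj_mem e (schurProj K V lam).toLinearMap S.toSubmodule (fun t => by
      rw [Representation.IntertwiningMap.toLinearMap_apply, (schurProj K V lam).isIntertwining]
      exact S.apply_mem_toSubmodule _ hx) lam
  have htop (S : Subrepresentation (schurRep lam (stdRep K V))) {x : ⨂[K] _ : Cell lam, V}
      (hx : schurProj K V lam x ∈ S) (h0 : schurProj K V lam (weightProj e lam x) ≠ 0) :
      S = ⊤ := by
    obtain ⟨a, ha⟩ := Submodule.mem_span_singleton.mp
      (schurProj_weightProj_mem_span e hlam le_rfl x)
    have h1 := hcomp S hx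
    rw [← ha] at h0 h1
    exact eq_top_of_schurVec_mem e S
      ((S.toSubmodule.smul_mem_iff (left_ne_zero_of_smul h0)).mp h1)
  have : Nontrivial (Subrepresentation (schurRep lam (stdRep K V))) :=
    ⟨⊥, ⊤, fun h => hHW.ne_zero (by
      have : schurVec lam e ∈ (⊤ : Subrepresentation (schurRep lam (stdRep K V))).toSubmodule :=
        Submodule.mem_top
      rw [← h] at this
      exact (Submodule.mem_bot K).mp this)⟩
  refine ⟨fun S => ?_⟩
  obtain ⟨T, hT⟩ := isSemisimple_schurRep.exists_isCompl S
  have hsup := (isCompl_toSubmodule_iff S T).mpr hT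
  obtain ⟨s, hs, t, ht, hst⟩ := Submodule.mem_sup.mp
    (show schurVec lam e ∈ S.toSubmodule ⊔ T.toSubmodule by
      rw [hsup.sup_eq_top]; exact Submodule.mem_top)
  obtain ⟨x, rfl⟩ := schurProj_surjective s
  obtain ⟨y, rfl⟩ := schurProj_surjective t
  by_cases hx0 : schurProj K V lam (weightProj e lam x) = 0
  · by_cases hy0 : schurProj K V lam (weightProj e lam y) = 0
    · exfalso
      have h0 : schurProj K V lam (x + y - tensorBasis _ e Sigma.fst) = 0 := by
        rw [map_sub, map_add, hst]
        exact sub_self _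
      have h1 := map_weightProj_mem e (schurProj K V lam).toLinearMap ⊥ (fun t => by
        rw [Representation.IntertwiningMap.toLinearMap_apply,
          (schurProj K V lam).isIntertwining, h0, map_zero]
        exact Submodule.zero_mem _) lam
      rw [Submodule.mem_bot, Representation.IntertwiningMap.toLinearMap_apply, map_sub, map_add,
        map_sub, map_add, hx0, hy0, weightProj_basis, if_pos (content_fst lam), add_zero,
        zero_sub, neg_eq_zero] at h1
      exact hHW.ne_zero h1
    · have hT1 := htop T ht hy0
      rw [hT1] at hT
      exact Or.inl (by simpa using hT.inf_eq_bot)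
  · exact Or.inr (htop S hs hx0)

/-- The weights of `V^lam` have at most the height of `lam`, and `schurVec` spans the vectors of
maximal height. -/
theorem height_le_of_isHighestWeightVector [CharZero K] (e : Basis (Fin m) K V)
    {mu : Fin m → ℕ} {u : schurSubmodule K V lam} (hlam : Antitone lam)
    (hu : IsHighestWeightVector e (schurRep lam (stdRep K V)) mu u) :
    height mu ≤ height lam ∧ (height lam ≤ height mu → u ∈ K ∙ schurVec lam e) := by
  obtain ⟨x, rfl⟩ := schurProj_surjective u
  have h1 := map_weightProj_eq_of_torus_eigenvector e (schurProj K V lam).toLinearMap mu x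
    fun t => by
      rw [Representation.IntertwiningMap.toLinearMap_apply, (schurProj K V lam).isIntertwining,
        hu.apply_eq _ (isUpperTriangular_torusElt e t), diagChar_torusElt]
      rfl
  rw [Representation.IntertwiningMap.toLinearMap_apply,
    Representation.IntertwiningMap.toLinearMap_apply] at h1
  refine ⟨?_, fun h => ?_⟩
  · by_contra hlt
    refine hu.ne_zero ?_
    classical
    rw [← h1]
    refine schurProj_eq_zero_of_mem_aboveHeight e hlam ?_
    rw [weightProj_apply]
    refine Submodule.sum_mem _ fun f hf => Submodule.smul_mem _ _ (Submodule.subset_span ⟨f, ?_, rfl⟩)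
    rw [Set.mem_ofPred_eq, (Finset.mem_filter.mp hf).2]
    exact not_le.mp hlt
  · rw [← h1]
    exact schurProj_weightProj_mem_span e hlam h x

/-- An isomorphism maps the highest weight vector of `V^lam` to a highest weight vector of `V^mu`, so
`lam` and `mu` have the same height; hence the image is a multiple of `schurVec`. -/
theorem eq_of_schurRep_equiv [CharZero K] (e : Basis (Fin m) K V) {mu : Fin m → ℕ}
    (hlam : Antitone lam) (hmu : Antitone mu)
    (φ : (schurRep lam (stdRep K V)).Equiv (schurRep mu (stdRep K V))) : lam = mu := by
  have h1 := isHighestWeightVector_schurVec e hlam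
  have h2 := isHighestWeightVector_schurVec e hmu
  have h3 := h1.map φ.toIntertwiningMap fun h0 => h1.ne_zero
    (φ.toLinearEquiv.injective (h0.trans (map_zero φ.toLinearEquiv).symm))
  have h4 := h2.map φ.symm.toIntertwiningMap fun h0 => h2.ne_zero
    (φ.symm.toLinearEquiv.injective (h0.trans (map_zero φ.symm.toLinearEquiv).symm))
  obtain ⟨a, ha⟩ := Submodule.mem_span_singleton.mp ((height_le_of_isHighestWeightVector e hmu h3).2
    (height_le_of_isHighestWeightVector e hlam h4).1)
  refine h3.weight_unique ⟨h3.ne_zero, fun g hg => ?_⟩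
  rw [← ha, map_smul, h2.apply_eq g hg, smul_comm]

end Weyl

/-! ### Polynomials vanishing along a dominant map -/

theorem MvPolynomial.eval_aeval {K σ τ : Type*} [CommSemiring K] (y : τ → K)
    (f : σ → MvPolynomial τ K) (p : MvPolynomial σ K) :
    MvPolynomial.eval y (MvPolynomial.aeval f p) =
      MvPolynomial.eval (fun i => MvPolynomial.eval y (f i)) p := by
  induction p using MvPolynomial.induction_on <;> simp_all

theorem MvPolynomial.polynomial_eval_aeval {K σ : Type*} [CommSemiring K] (s : K)
    (f : σ → Polynomial K) (p : MvPolynomial σ K) :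
    (MvPolynomial.aeval f p).eval s = MvPolynomial.eval (fun i => (f i).eval s) p := by
  induction p using MvPolynomial.induction_on <;> simp_all [Polynomial.algebraMap_eq]

theorem MvPolynomial.IsHomogeneous.eval_smul {K σ : Type*} [CommSemiring K]
    {p : MvPolynomial σ K} {n : ℕ} (hp : p.IsHomogeneous n) (s : K) (w : σ → K) :
    MvPolynomial.eval (s • w) p = s ^ n * MvPolynomial.eval w p := by
  rw [MvPolynomial.eval_eq, MvPolynomial.eval_eq, Finset.mul_sum]
  refine Finset.sum_congr rfl fun d hd => ?_
  have hn : ∑ i ∈ d.support, d i = n := by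
    rw [← hp (MvPolynomial.mem_support_iff.mp hd)]
    simp [Finsupp.weight_apply, Finsupp.sum]
  simp only [Pi.smul_apply, smul_eq_mul, mul_pow, Finset.prod_mul_distrib,
    Finset.prod_pow_eq_pow_sum, hn]
  ring

/-- If a polynomial vanishes on a second order deformation of `a` in every tangent direction, then
it is zero: its leading form at `a` vanishes identically. -/
theorem MvPolynomial.eq_zero_of_forall_tangent {K σ : Type*} [Field K] [Infinite K]
    (p : MvPolynomial σ K) (a : σ → K)
    (h : ∀ y : σ → K, ∃ (z : σ → K) (D : Polynomial K), D ≠ 0 ∧ ∀ s : K, D.eval s ≠ 0 →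
      MvPolynomial.eval (a + s • y + s ^ 2 • z) p = 0) : p = 0 := by
  set q : MvPolynomial σ K := MvPolynomial.aeval (fun i => MvPolynomial.X i + MvPolynomial.C (a i)) p
  have hq (y : σ → K) : MvPolynomial.eval y q = MvPolynomial.eval (y + a) p := by
    simp only [q, MvPolynomial.eval_aeval, map_add, MvPolynomial.eval_X, MvPolynomial.eval_C]
    rfl
  suffices hcomp : ∀ k, MvPolynomial.homogeneousComponent k q = 0 by
    refine MvPolynomial.funext fun y => ?_
    have h1 := hq (y - a)
    rw [sub_add_cancel] at h1
    rw [← h1, ← MvPolynomial.sum_homogeneousComponent q]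
    simp [hcomp]
  intro k
  induction k using Nat.strong_induction_on with
  | h k ih =>
    refine MvPolynomial.funext fun y => ?_
    obtain ⟨z, D, hD, hev⟩ := h y
    set P : ℕ → Polynomial K := fun j =>
      MvPolynomial.aeval (fun i => Polynomial.C (y i) + Polynomial.X * Polynomial.C (z i))
        (MvPolynomial.homogeneousComponent j q)
    have hP (s : K) (j : ℕ) : (P j).eval s =
        MvPolynomial.eval (y + s • z) (MvPolynomial.homogeneousComponent j q) := by
      simp only [P, MvPolynomial.polynomial_eval_aeval, Polynomial.eval_add, Polynomial.eval_C,
        Polynomial.eval_mul, Polynomial.eval_X]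
      rfl
    have hzero : ∑ j ∈ Finset.range (q.totalDegree + 1), Polynomial.X ^ j * P j = 0 := by
      have h1 : D * ∑ j ∈ Finset.range (q.totalDegree + 1), Polynomial.X ^ j * P j = 0 := by
        refine Polynomial.funext fun s => ?_
        rw [Polynomial.eval_mul, Polynomial.eval_zero, mul_eq_zero, or_iff_not_imp_left]
        intro hs
        rw [← hev s hs, Polynomial.eval_finsetSum]
        have h2 : a + s • y + s ^ 2 • z = s • (y + s • z) + a := by
          rw [smul_add, smul_smul, ← sq, add_assoc, add_comm]
        rw [h2, ← hq]
        conv_rhs => rw [← MvPolynomial.sum_homogeneousComponent q, map_sum]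
        refine Finset.sum_congr rfl fun j _ => ?_
        rw [Polynomial.eval_mul, Polynomial.eval_pow, Polynomial.eval_X, hP]
        exact ((MvPolynomial.homogeneousComponent_isHomogeneous j q).eval_smul s _).symm
      exact (mul_eq_zero.mp h1).resolve_left hD
    by_cases hk : k ∈ Finset.range (q.totalDegree + 1)
    · have h1 := congrArg (Polynomial.coeff · k) hzero
      simp only [Polynomial.finsetSum_coeff, Polynomial.coeff_X_pow_mul',
        Polynomial.coeff_zero] at h1
      rw [Finset.sum_eq_single k] at h1
      · rw [if_pos le_rfl, Nat.sub_self, Polynomial.coeff_zero_eq_eval_zero, hP] at h1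
        simpa using h1
      · intro j _ hj
        split_ifs with hjk
        · simp [P, ih j (lt_of_le_of_ne hjk hj)]
        · rfl
      · exact fun hk' => absurd hk hk'
    · rw [MvPolynomial.homogeneousComponent_eq_zero]
      simpa using hk

/-! ### Evaluation of `Sym(⋀² V) ⊗ Sym(V)` at points -/

section Evaluation

open Module

variable {K : Type*} [Field K] {V : Type*} [AddCommGroup V] [Module K V]

variable (K V) in
/-- The product of two vectors in the exterior square. -/
def wedge : V →ₗ[K] V →ₗ[K] ⋀[K]^2 V :=
  LinearMap.mk₂ K (fun x y => exteriorPower.ιMulti K 2 ![x, y])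
    (fun x x' y => by simpa using (exteriorPower.ιMulti K 2).map_vecCons_add ![y] x x')
    (fun c x y => by simpa using (exteriorPower.ιMulti K 2).map_vecCons_smul ![y] c x)
    (fun x y y' => by
      have hu (z : V) : Function.update ![x, 0] 1 z = ![x, z] := by
        funext i
        fin_cases i <;> rfl
      have := (exteriorPower.ιMulti (M := V) K 2).map_update_add ![x, 0] 1 y y'
      rwa [hu, hu, hu] at this)
    (fun c x y => by
      have hu (z : V) : Function.update ![x, 0] 1 z = ![x, z] := by
        funext i
        fin_cases i <;> rfl
      have := (exteriorPower.ιMulti (M := V) K 2).map_update_smul ![x, 0] 1 c y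
      rwa [hu, hu] at this)

theorem wedge_apply (x y : V) : wedge K V x y = exteriorPower.ιMulti K 2 ![x, y] := rfl

theorem wedge_swap (x y : V) : wedge K V y x = -wedge K V x y := by
  rw [wedge_apply, wedge_apply, ← (exteriorPower.ιMulti K 2).map_swap ![x, y] zero_ne_one]
  congr 1
  funext i
  fin_cases i <;> rfl

theorem map_wedge (g : V →ₗ[K] V) (x y : V) :
    exteriorPower.map 2 g (wedge K V x y) = wedge K V (g x) (g y) := by
  rw [wedge_apply, wedge_apply, exteriorPower.map_apply_ιMulti]
  congr 1
  funext i
  fin_cases i <;> rfl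

theorem dual_exteriorSquare_ext {m : ℕ} (e : Basis (Fin m) K V) {ω ω' : Dual K (⋀[K]^2 V)}
    (h : ∀ i j, i < j → ω (wedge K V (e i) (e j)) = ω' (wedge K V (e i) (e j))) : ω = ω' := by
  refine exteriorPower.linearMap_ext (Basis.ext_alternating e fun v hv => ?_)
  have hv' : (fun i => e (v i)) = ![e (v 0), e (v 1)] := by
    funext i
    fin_cases i <;> rfl
  simp only [LinearMap.compAlternatingMap_apply, hv']
  change ω (wedge K V _ _) = ω' (wedge K V _ _)
  rcases lt_or_gt_of_ne (hv.ne zero_ne_one) with hlt | hlt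
  · exact h _ _ hlt
  · rw [wedge_swap, map_neg, map_neg, h _ _ hlt]

/-- Evaluation of an element of the symmetric power of `W` at a linear form. -/
def symEval {W : Type*} [AddCommGroup W] [Module K W] (d : ℕ) (ω : Dual K W) :
    symPower K W d →ₗ[K] K :=
  (SymmetricAlgebra.lift ω).toLinearMap ∘ₗ (symPower K W d).subtype

theorem symEval_symPowerRep {G W : Type*} [Monoid G] [AddCommGroup W] [Module K W] (d : ℕ)
    (ρ : Representation K G W) (ω : Dual K W) (g : G) :
    symEval d ω ∘ₗ symPowerRep d ρ g = symEval d (ω ∘ₗ ρ g) := by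
  have h : (SymmetricAlgebra.lift ω).comp (symAlgMap (ρ g)) =
      SymmetricAlgebra.lift (ω ∘ₗ ρ g) := by
    apply SymmetricAlgebra.algHom_ext
    ext x
    simp [symAlgMap]
  ext x
  exact DFunLike.congr_fun h (x : SymmetricAlgebra K W)

theorem symEval_smul {W : Type*} [AddCommGroup W] [Module K W] (d : ℕ) (c : K) (ω : Dual K W) :
    symEval d (c • ω) = c ^ d • symEval d ω := by
  ext ⟨x, hx⟩
  change SymmetricAlgebra.lift (c • ω) x = c ^ d * SymmetricAlgebra.lift ω x
  induction hx using Submodule.pow_induction_on_left' with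
  | algebraMap r => simp
  | add x y i _ _ hx hy => rw [map_add, map_add, hx, hy, mul_add]
  | mem_mul w hw i x hx ih =>
    obtain ⟨w, rfl⟩ := hw
    rw [map_mul, map_mul, ih, SymmetricAlgebra.lift_ι_apply, SymmetricAlgebra.lift_ι_apply,
      LinearMap.smul_apply, smul_eq_mul, Nat.succ_eq_add_one]
    ring

variable (K V) in
/-- The representation `Sym^d(⋀² V) ⊗ Sym^k V` of `GL(V)`. -/
abbrev symTensorRep (d k : ℕ) : Representation K (LinearMap.GeneralLinearGroup K V)
    (symPower K (⋀[K]^2 V) d ⊗[K] symPower K V k) :=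
  (symPowerRep d (extPowerRep 2 (stdRep K V))).tprod (symPowerRep k (stdRep K V))

/-- Evaluation of an element of `Sym^d(⋀² V) ⊗ Sym^k V`, as a polynomial function, at a pair
consisting of an alternating form and a linear form on `V`. -/
def evalAt (d k : ℕ) (ω : Dual K (⋀[K]^2 V)) (ξ : Dual K V) :
    symPower K (⋀[K]^2 V) d ⊗[K] symPower K V k →ₗ[K] K :=
  LinearMap.mul' K K ∘ₗ TensorProduct.map (symEval d ω) (symEval k ξ)

theorem evalAt_apply_symTensorRep (d k : ℕ) (ω : Dual K (⋀[K]^2 V)) (ξ : Dual K V)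
    (g : LinearMap.GeneralLinearGroup K V) (u) :
    evalAt d k ω ξ (symTensorRep K V d k g u) =
      evalAt d k (ω ∘ₗ exteriorPower.map 2 (g : V →ₗ[K] V)) (ξ ∘ₗ (g : V →ₗ[K] V)) u := by
  have h : evalAt d k ω ξ ∘ₗ symTensorRep K V d k g =
      evalAt d k (ω ∘ₗ extPowerRep 2 (stdRep K V) g) (ξ ∘ₗ stdRep K V g) :=
    TensorProduct.ext' fun x y => congrArg₂ (· * ·)
      (LinearMap.congr_fun (symEval_symPowerRep d (extPowerRep 2 (stdRep K V)) ω g) x)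
      (LinearMap.congr_fun (symEval_symPowerRep k (stdRep K V) ξ g) y)
  exact LinearMap.congr_fun h u

theorem evalAt_smul_smul (d k : ℕ) (a b : K) (ω : Dual K (⋀[K]^2 V)) (ξ : Dual K V) (u) :
    evalAt d k (a • ω) (b • ξ) u = a ^ d * b ^ k * evalAt d k ω ξ u := by
  have h : evalAt d k (a • ω) (b • ξ) = (a ^ d * b ^ k) • evalAt d k ω ξ := by
    refine TensorProduct.ext' fun x y => ?_
    change symEval d (a • ω) x * symEval k (b • ξ) y =
      (a ^ d * b ^ k) * (symEval d ω x * symEval k ξ y)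
    rw [symEval_smul, symEval_smul, LinearMap.smul_apply, LinearMap.smul_apply, smul_eq_mul,
      smul_eq_mul]
    ring
  rw [h, LinearMap.smul_apply, smul_eq_mul]

/-- Elements of `Sym^d(⋀² V) ⊗ Sym^k V` are polynomial functions of the values of an alternating
form and a linear form on bases. -/
theorem exists_polynomial_model {I J : Type*} (b : Basis I K (⋀[K]^2 V)) (c : Basis J K V)
    (d k : ℕ) :
    ∃ Ψ : symPower K (⋀[K]^2 V) d ⊗[K] symPower K V k →ₗ[K] MvPolynomial (I ⊕ J) K,
      Function.Injective Ψ ∧ ∀ ω ξ u, evalAt d k ω ξ u =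
        MvPolynomial.eval (Sum.elim (fun i => ω (b i)) fun j => ξ (c j)) (Ψ u) := by
  set Θ := (Algebra.TensorProduct.congr (SymmetricAlgebra.equivMvPolynomial b)
    (SymmetricAlgebra.equivMvPolynomial c)).trans
      (MvPolynomial.tensorEquivSum K I J K)
  refine ⟨Θ.toLinearMap ∘ₗ TensorProduct.map (symPower K (⋀[K]^2 V) d).subtype
    (symPower K V k).subtype, ?_, fun ω ξ u => ?_⟩
  · exact Θ.injective.comp (TensorProduct.map_injective_of_flat_flat _ _
      (Submodule.injective_subtype _) (Submodule.injective_subtype _))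
  · have h : (Algebra.TensorProduct.productMap (SymmetricAlgebra.lift ω) (SymmetricAlgebra.lift ξ)) =
        (MvPolynomial.aeval (Sum.elim (fun i => ω (b i)) fun j => ξ (c j))).comp Θ.toAlgHom := by
      refine Algebra.TensorProduct.ext ?_ ?_
      · apply SymmetricAlgebra.algHom_ext
        refine b.ext fun i => ?_
        simp [Θ]
      · apply SymmetricAlgebra.algHom_ext
        refine c.ext fun i => ?_
        simp [Θ]
    have h2 : evalAt d k ω ξ = (Algebra.TensorProduct.productMap (SymmetricAlgebra.lift ω)
        (SymmetricAlgebra.lift ξ)).toLinearMap ∘ₗ TensorProduct.map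
          (symPower K (⋀[K]^2 V) d).subtype (symPower K V k).subtype :=
      TensorProduct.ext' fun x y => rfl
    rw [h2, h]
    rfl

end Evaluation

/-! ### The base point -/

section BasePoint

open Module

variable {K : Type*} [Field K] {V : Type*} [AddCommGroup V] [Module K V] {n : ℕ}

/-- The involution of the indices exchanging `2i` and `2i + 1`. -/
def partner (i : Fin (2 * n)) : Fin (2 * n) :=
  ⟨if (i : ℕ) % 2 = 0 then i + 1 else i - 1, by split_ifs <;> omega⟩

theorem partner_val (i : Fin (2 * n)) :
    (partner i : ℕ) = if (i : ℕ) % 2 = 0 then (i : ℕ) + 1 else i - 1 := rfl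

theorem partner_partner (i : Fin (2 * n)) : partner (partner i) = i := by
  refine Fin.ext ?_
  simp only [partner_val]
  split_ifs <;> omega

/-- The alternating form for which `e (2i)` and `e (2i + 1)` form hyperbolic pairs. -/
def baseForm (e : Basis (Fin (2 * n)) K V) : Dual K (⋀[K]^2 V) :=
  ∑ i : Fin n, exteriorPower.pairingDual K V 2
    (exteriorPower.ιMulti K 2 ![e.coord ⟨2 * i, by omega⟩, e.coord ⟨2 * i + 1, by omega⟩])

/-- The linear form which is `1` on the `e (2i)` and `0` on the `e (2i + 1)`. -/
def baseCovector (e : Basis (Fin (2 * n)) K V) : Dual K V :=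
  ∑ i : Fin n, e.coord ⟨2 * i, by omega⟩

theorem baseCovector_apply (e : Basis (Fin (2 * n)) K V) (i : Fin (2 * n)) :
    baseCovector e (e i) = if (i : ℕ) % 2 = 0 then 1 else 0 := by
  rw [baseCovector, LinearMap.sum_apply]
  simp only [Basis.coord_apply, Basis.repr_self, Finsupp.single_apply]
  split_ifs with h
  · rw [Finset.sum_eq_single ⟨(i : ℕ) / 2, by omega⟩]
    · exact if_pos (Fin.ext (by simp only; omega))
    · intro j _ hj
      refine if_neg fun hij => hj (Fin.ext ?_)
      have := congrArg Fin.val hij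
      simp only at this ⊢
      omega
    · simp
  · refine Finset.sum_eq_zero fun j _ => if_neg fun hij => h ?_
    have := congrArg Fin.val hij
    simp only at this
    omega

theorem baseForm_wedge (e : Basis (Fin (2 * n)) K V) (i j : Fin (2 * n)) :
    baseForm e (wedge K V (e i) (e j)) =
      if j = partner i then (if (i : ℕ) % 2 = 0 then 1 else -1) else 0 := by
  have h1 : baseForm e (wedge K V (e i) (e j)) = ∑ k : Fin n,
      ((if i = ⟨2 * k, by omega⟩ then (1 : K) else 0) *
          (if j = ⟨2 * k + 1, by omega⟩ then 1 else 0) -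
        (if i = ⟨2 * k + 1, by omega⟩ then 1 else 0) *
          (if j = ⟨2 * k, by omega⟩ then 1 else 0)) := by
    rw [baseForm, LinearMap.sum_apply]
    refine Finset.sum_congr rfl fun k _ => ?_
    rw [wedge_apply, exteriorPower.pairingDual_ιMulti_ιMulti, Matrix.det_fin_two]
    simp [Finsupp.single_apply]
  rw [h1, Finset.sum_eq_single ⟨(i : ℕ) / 2, by omega⟩]
  · simp only [Fin.ext_iff, partner_val]
    split_ifs <;> first | omega | simp
  · intro k _ hk
    have hk' : (i : ℕ) / 2 ≠ k := fun h => hk (Fin.ext h.symm)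
    have h2 : i ≠ ⟨2 * k, by omega⟩ := fun h => by
      have := congrArg Fin.val h
      simp only at this
      omega
    have h3 : i ≠ ⟨2 * k + 1, by omega⟩ := fun h => by
      have := congrArg Fin.val h
      simp only at this
      omega
    rw [if_neg h2, if_neg h3, zero_mul, zero_mul, sub_zero]
  · simp

/-- The matrix of a tangent vector to the group of upper triangular elements which moves the base
point in the direction given by the alternating form with values `η` and the covector with
values `ζ`. The entries above the diagonal blocks of size two are determined by `η`, and those in
the blocks by `ζ` and the values of `η` on the hyperbolic pairs; `S j` is the contribution of the
former entries to the value at `j` of the direction of the covector. -/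
def tangentMatrix (η : Fin (2 * n) → Fin (2 * n) → K) (ζ : Fin (2 * n) → K)
    (k j : Fin (2 * n)) : K :=
  let S : Fin (2 * n) → K := fun j =>
    ∑ k : Fin (2 * n), if (k : ℕ) % 2 = 0 ∧ k < j ∧ k ≠ partner j then -η (partner k) j else 0
  if j < k then 0
  else if k = j then
    (if (j : ℕ) % 2 = 0 then ζ j - S j else η (partner j) j - (ζ (partner j) - S (partner j)))
  else if k = partner j then ζ j - S j
  else (if (k : ℕ) % 2 = 0 then -1 else 1) * η (partner k) j

theorem tangentMatrix_of_lt (η : Fin (2 * n) → Fin (2 * n) → K) (ζ : Fin (2 * n) → K)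
    {k j : Fin (2 * n)} (h : j < k) : tangentMatrix η ζ k j = 0 := by
  simp only [tangentMatrix, if_pos h]

/-- The vector `tangentMatrix η ζ` moves the covector `baseCovector` in the direction `ζ`. -/
theorem sum_tangentMatrix (η : Fin (2 * n) → Fin (2 * n) → K) (ζ : Fin (2 * n) → K)
    (j : Fin (2 * n)) :
    ∑ k : Fin (2 * n), (if (k : ℕ) % 2 = 0 then tangentMatrix η ζ k j else 0) = ζ j := by
  set S : Fin (2 * n) → K := fun j =>
    ∑ k : Fin (2 * n), if (k : ℕ) % 2 = 0 ∧ k < j ∧ k ≠ partner j then -η (partner k) j else 0 with hS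
  set p : Fin (2 * n) := if (j : ℕ) % 2 = 0 then j else partner j with hp
  have h (k : Fin (2 * n)) : (if (k : ℕ) % 2 = 0 then tangentMatrix η ζ k j else 0) =
      (if k = p then ζ j - S j else 0) +
        if (k : ℕ) % 2 = 0 ∧ k < j ∧ k ≠ partner j then -η (partner k) j else 0 := by
    have hpv : (p : ℕ) = if (j : ℕ) % 2 = 0 then (j : ℕ) else j - 1 := by
      rw [hp]
      split_ifs with h1
      · rfl
      · rw [partner_val, if_neg h1]
    have ht : tangentMatrix η ζ k j = if j < k then 0 else if k = j then
        (if (j : ℕ) % 2 = 0 then ζ j - S j else η (partner j) j - (ζ (partner j) - S (partner j)))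
        else if k = partner j then ζ j - S j
        else (if (k : ℕ) % 2 = 0 then -1 else 1) * η (partner k) j := rfl
    rw [ht]
    simp only [Fin.ext_iff, Fin.lt_def, partner_val, hpv, ne_eq]
    split_ifs <;> first | omega | simp
  rw [Finset.sum_congr rfl fun k _ => h k, Finset.sum_add_distrib, Finset.sum_ite_eq' Finset.univ p,
    if_pos (Finset.mem_univ p)]
  exact sub_add_cancel _ _

/-- The vector `tangentMatrix η ζ` moves the form `baseForm` in the direction `η`. -/
theorem tangentMatrix_partner_sub (η : Fin (2 * n) → Fin (2 * n) → K) (ζ : Fin (2 * n) → K)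
    {i j : Fin (2 * n)} (hij : i < j) :
    (if (i : ℕ) % 2 = 0 then 1 else -1) * tangentMatrix η ζ (partner i) j -
      (if (j : ℕ) % 2 = 0 then 1 else -1) * tangentMatrix η ζ (partner j) i = η i j := by
  have hij' : (i : ℕ) < j := hij
  by_cases h : j = partner i
  · subst h
    have hi : (i : ℕ) % 2 = 0 := by
      rw [partner_val] at hij'
      split_ifs at hij' <;> omega
    have hj : ¬ (partner i : ℕ) % 2 = 0 := by
      rw [partner_val, if_pos hi]
      omega
    rw [partner_partner, if_pos hi, if_neg hj]
    simp only [tangentMatrix, lt_irrefl, if_false, if_true, if_neg hj, if_pos hi, partner_partner]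
    ring
  · have h1 : tangentMatrix η ζ (partner j) i = 0 := by
      refine tangentMatrix_of_lt η ζ ?_
      rw [Fin.lt_def, partner_val]
      have : (j : ℕ) ≠ partner i := fun h' => h (Fin.ext h')
      rw [partner_val] at this
      split_ifs at this ⊢ <;> omega
    have h2 : ¬ j < partner i := by
      rw [Fin.lt_def, partner_val]
      have : (j : ℕ) ≠ partner i := fun h' => h (Fin.ext h')
      rw [partner_val] at this
      split_ifs at this ⊢ <;> omega
    have h3 : ¬ partner i = partner j := fun h' => hij.ne (by
      rw [← partner_partner i, h', partner_partner])
    rw [h1]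
    simp only [tangentMatrix, if_neg h2, if_neg (Ne.symm h), if_neg h3, partner_partner]
    by_cases hi : (i : ℕ) % 2 = 0
    · have hi' : ¬ (partner i : ℕ) % 2 = 0 := by
        rw [partner_val, if_pos hi]
        omega
      rw [if_pos hi, if_neg hi']
      ring
    · have hi' : (partner i : ℕ) % 2 = 0 := by
        rw [partner_val, if_neg hi]
        omega
      rw [if_neg hi, if_pos hi']
      ring

/-- The tangent vectors to the group of upper triangular elements move the base point in all
directions. -/
theorem exists_tangent (e : Basis (Fin (2 * n)) K V) (η : Dual K (⋀[K]^2 V)) (ζ : Dual K V) :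
    ∃ E : V →ₗ[K] V, IsUpperTriangular e E ∧ baseCovector e ∘ₗ E = ζ ∧
      ∀ s : K, baseForm e ∘ₗ exteriorPower.map 2 (1 + s • E) =
        baseForm e + s • η + s ^ 2 • (baseForm e ∘ₗ exteriorPower.map 2 E) := by
  set A := tangentMatrix (fun i j => η (wedge K V (e i) (e j))) fun i => ζ (e i)
  set E : V →ₗ[K] V := e.constr K fun j => ∑ k, A k j • e k with hE
  have hEe (j) : E (e j) = ∑ k, A k j • e k := e.constr_basis K _ j
  refine ⟨E, fun i j hij => ?_, e.ext fun j => ?_, fun s => dual_exteriorSquare_ext e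
    fun i j hij => ?_⟩
  · rw [hEe, Basis.repr_sum_self]
    exact tangentMatrix_of_lt _ _ hij
  · rw [LinearMap.comp_apply, hEe, map_sum]
    simp only [map_smul, baseCovector_apply, smul_eq_mul, mul_ite, mul_one, mul_zero]
    exact sum_tangentMatrix _ _ j
  · have hright (i j) : baseForm e (wedge K V (e i) (E (e j))) =
        (if (i : ℕ) % 2 = 0 then 1 else -1) * A (partner i) j := by
      rw [hEe, map_sum, map_sum]
      simp only [map_smul, baseForm_wedge, smul_eq_mul, mul_ite, mul_zero]
      rw [Finset.sum_ite_eq' Finset.univ (partner i), if_pos (Finset.mem_univ _)]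
      split_ifs <;> ring
    have hleft : baseForm e (wedge K V (E (e i)) (e j)) =
        -((if (j : ℕ) % 2 = 0 then 1 else -1) * A (partner j) i) := by
      rw [wedge_swap, map_neg, hright]
    have hη : baseForm e (wedge K V (e i) (E (e j))) + baseForm e (wedge K V (E (e i)) (e j)) =
        η (wedge K V (e i) (e j)) := by
      rw [hright, hleft, ← sub_eq_add_neg]
      exact tangentMatrix_partner_sub _ _ hij
    simp only [LinearMap.comp_apply, LinearMap.add_apply, LinearMap.smul_apply, map_wedge,
      Module.End.one_apply, map_add, map_smul, smul_eq_mul, ← hη]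
    ring

/-- The elements `1 + s • E` are invertible for almost all `s`. -/
theorem exists_det_one_add_smul [FiniteDimensional K V] (E : V →ₗ[K] V) :
    ∃ D : Polynomial K, D ≠ 0 ∧ ∀ s : K, D.eval s = LinearMap.det (1 + s • E) := by
  set b := Module.finBasis K V
  set M := LinearMap.toMatrix b b E
  refine ⟨(1 + (Polynomial.X : Polynomial K) • M.map Polynomial.C).det, ?_, fun s => ?_⟩
  · intro h0
    have := congrArg (Polynomial.eval 0) h0
    rw [← Polynomial.coe_evalRingHom, RingHom.map_det] at this
    have h1 : (Polynomial.evalRingHom (0 : K)).mapMatrix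
        (1 + (Polynomial.X : Polynomial K) • M.map Polynomial.C) = 1 := by
      ext i j
      simp only [RingHom.mapMatrix_apply, Matrix.map_apply, Matrix.add_apply, Matrix.smul_apply,
        Matrix.one_apply, smul_eq_mul, Polynomial.coe_evalRingHom]
      split_ifs <;> simp
    rw [h1, Matrix.det_one] at this
    simp at this
  · rw [← LinearMap.det_toMatrix b, ← Polynomial.coe_evalRingHom, RingHom.map_det]
    congr 1
    ext i j
    simp [M, Matrix.one_apply, LinearMap.toMatrix_one]
    split_ifs <;> simp [mul_comm]

/-- An element of `Sym^d(⋀² V) ⊗ Sym^k V` all of whose translates by upper triangular elements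
vanish at the base point is zero. -/
theorem eq_zero_of_evalAt_base_eq_zero [CharZero K] [FiniteDimensional K V]
    (e : Basis (Fin (2 * n)) K V) (d k : ℕ) (u : symPower K (⋀[K]^2 V) d ⊗[K] symPower K V k)
    (hu : ∀ g : LinearMap.GeneralLinearGroup K V, IsUpperTriangular e (g : V →ₗ[K] V) →
      evalAt d k (baseForm e) (baseCovector e) (symTensorRep K V d k g u) = 0) : u = 0 := by
  set b := Module.finBasis K (⋀[K]^2 V)
  obtain ⟨Ψ, hΨ, hev⟩ := exists_polynomial_model b e d k
  refine (map_eq_zero_iff Ψ hΨ).mp (MvPolynomial.eq_zero_of_forall_tangent (Ψ u)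
    (Sum.elim (fun i => baseForm e (b i)) fun j => baseCovector e (e j)) fun y => ?_)
  obtain ⟨E, hE, hcov, hform⟩ := exists_tangent e (b.constr K fun i => y (Sum.inl i))
    (e.constr K fun j => y (Sum.inr j))
  obtain ⟨D, hD, hDe⟩ := exists_det_one_add_smul E
  refine ⟨Sum.elim (fun i => baseForm e (exteriorPower.map 2 E (b i))) 0, D, hD, fun s hs => ?_⟩
  obtain ⟨g, hg⟩ := (LinearMap.isUnit_iff_isUnit_det _).mpr
    (isUnit_iff_ne_zero.mpr (hDe s ▸ hs : LinearMap.det (1 + s • E) ≠ 0))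
  have h := hu g (fun i j hij => by
    rw [hg, LinearMap.add_apply, LinearMap.smul_apply, map_add, map_smul, Finsupp.add_apply,
      Finsupp.smul_apply, hE i j hij, Module.End.one_apply, Basis.repr_self,
      Finsupp.single_eq_of_ne hij.ne', smul_zero, add_zero])
  rw [evalAt_apply_symTensorRep, hg, hform, hev] at h
  rw [← h]
  refine congrArg (fun x => MvPolynomial.eval x (Ψ u)) (funext fun a => ?_)
  rcases a with i | j
  · simp
  · have h2 := LinearMap.congr_fun hcov (e j)
    rw [LinearMap.comp_apply, Basis.constr_basis] at h2
    simp [h2]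

/-- A highest weight vector does not vanish at the base point: otherwise it would vanish on the orbit
of the base point under the upper triangular elements. -/
theorem IsHighestWeightVector.evalAt_base_ne_zero [CharZero K] [FiniteDimensional K V]
    {e : Basis (Fin (2 * n)) K V} {d k : ℕ} {lam : Fin (2 * n) → ℕ}
    {u : symPower K (⋀[K]^2 V) d ⊗[K] symPower K V k}
    (hu : IsHighestWeightVector e (symTensorRep K V d k) lam u) :
    evalAt d k (baseForm e) (baseCovector e) u ≠ 0 := fun h0 =>
  hu.ne_zero (eq_zero_of_evalAt_base_eq_zero e d k u fun g hg => by
    rw [hu.apply_eq g hg, map_smul, h0, smul_zero])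

/-- If some linear functional does not vanish on highest weight vectors, then the highest weight
vectors of given weight are unique up to scalars. -/
theorem IsHighestWeightVector.exists_eq_smul_of_functional {m : ℕ} {e : Basis (Fin m) K V}
    {E : Type*} [AddCommGroup E] [Module K E]
    {σ : Representation K (LinearMap.GeneralLinearGroup K V) E} {lam : Fin m → ℕ}
    (ev : E →ₗ[K] K) (hev : ∀ u, IsHighestWeightVector e σ lam u → ev u ≠ 0) {u u' : E}
    (hu : IsHighestWeightVector e σ lam u) (hu' : IsHighestWeightVector e σ lam u') :
    ∃ c : K, u' = c • u := by
  refine ⟨ev u' / ev u, ?_⟩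
  by_contra hne
  have h : IsHighestWeightVector e σ lam (u' - (ev u' / ev u) • u) := by
    refine ⟨sub_ne_zero.mpr hne, fun g hg => ?_⟩
    rw [map_sub, map_smul, hu'.apply_eq g hg, hu.apply_eq g hg, smul_sub, smul_comm]
  refine hev _ h ?_
  rw [map_sub, map_smul, smul_eq_mul, div_mul_cancel₀ _ (hev u hu), sub_self]

theorem IsHighestWeightVector.functional_apply {m : ℕ} {e : Basis (Fin m) K V}
    {E : Type*} [AddCommGroup E] [Module K E]
    {σ : Representation K (LinearMap.GeneralLinearGroup K V) E} {lam : Fin m → ℕ} {u : E}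
    (hu : IsHighestWeightVector e σ lam u) (ev : E →ₗ[K] K)
    {g : LinearMap.GeneralLinearGroup K V} (hg : IsUpperTriangular e (g : V →ₗ[K] V)) :
    ev (σ g u) = diagChar e lam (g : V →ₗ[K] V) * ev u := by
  rw [hu.apply_eq g hg, map_smul, smul_eq_mul]

/-- The highest weight vectors of given weight are unique up to scalars. -/
theorem IsHighestWeightVector.exists_eq_smul [CharZero K] [FiniteDimensional K V]
    {e : Basis (Fin (2 * n)) K V} {d k : ℕ} {lam : Fin (2 * n) → ℕ}
    {u u' : symPower K (⋀[K]^2 V) d ⊗[K] symPower K V k}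
    (hu : IsHighestWeightVector e (symTensorRep K V d k) lam u)
    (hu' : IsHighestWeightVector e (symTensorRep K V d k) lam u') : ∃ c : K, u' = c • u :=
  hu.exists_eq_smul_of_functional (evalAt (K := K) (V := V) d k (baseForm e) (baseCovector e))
    (fun _ h => h.evalAt_base_ne_zero) hu'

/-- A product over the indices `i < 2n` is the product over the pairs `2i`, `2i + 1`. -/
@[to_additive sum_fin_two_mul]
theorem prod_fin_two_mul {M : Type*} [CommMonoid M] (f : Fin (2 * n) → M) :
    ∏ i, f i = ∏ i : Fin n, (f ⟨2 * i, by omega⟩ * f ⟨2 * i + 1, by omega⟩) := by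
  rw [← ((finProdFinEquiv (m := n) (n := 2)).trans (finCongr (mul_comm n 2))).prod_comp,
    Fintype.prod_prod_type]
  refine Finset.prod_congr rfl fun i _ => ?_
  rw [Fin.prod_univ_two]
  congr 2 <;> refine Fin.ext ?_ <;> simp [finProdFinEquiv, add_comm]

theorem prod_parity_pow (lam : Fin (2 * n) → ℕ) (a b : K) :
    ∏ i : Fin (2 * n), (if (i : ℕ) % 2 = 0 then a else b) ^ lam i =
      a ^ (∑ i, oddPart lam i) * b ^ (∑ i, evenPart lam i) := by
  rw [← Finset.prod_pow_eq_pow_sum, ← Finset.prod_pow_eq_pow_sum, ← Finset.prod_mul_distrib,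
    prod_fin_two_mul]
  refine Finset.prod_congr rfl fun i _ => ?_
  rw [if_pos (by simp), if_neg (by simp)]
  rfl

/-- The torus elements scaling the `e (2i)` by `a` and the `e (2i + 1)` by `b` scale the base point,
and so the value there of an element of `Sym^d(⋀² V) ⊗ Sym^k V` is scaled by `(ab)^d a^k`. -/
theorem IsHighestWeightVector.sum_parts [CharZero K] [FiniteDimensional K V]
    {e : Basis (Fin (2 * n)) K V} {d k : ℕ} {lam : Fin (2 * n) → ℕ}
    {u : symPower K (⋀[K]^2 V) d ⊗[K] symPower K V k}
    (hu : IsHighestWeightVector e (symTensorRep K V d k) lam u) :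
    ∑ i, oddPart lam i = d + k ∧ ∑ i, evenPart lam i = d := by
  have key (a b : Kˣ) : (a : K) ^ (∑ i, oddPart lam i) * (b : K) ^ (∑ i, evenPart lam i) =
      (a * b : K) ^ d * (a : K) ^ k := by
    set t : Fin (2 * n) → Kˣ := fun i => if (i : ℕ) % 2 = 0 then a else b
    have ht (i) : (t i : K) = if (i : ℕ) % 2 = 0 then (a : K) else b := by
      simp only [t]
      split_ifs <;> rfl
    have h1 : baseForm e ∘ₗ exteriorPower.map 2 (torusElt e t : V →ₗ[K] V) =
        (a * b : K) • baseForm e := by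
      refine dual_exteriorSquare_ext e fun i j _ => ?_
      rw [LinearMap.comp_apply, map_wedge, torusElt_apply_basis, torusElt_apply_basis,
        LinearMap.smul_apply]
      simp only [map_smul, LinearMap.smul_apply, baseForm_wedge, smul_eq_mul]
      by_cases hj : j = partner i
      · rw [if_pos hj, hj, ht, ht, partner_val]
        split_ifs <;> first | omega | ring
      · rw [if_neg hj, mul_zero, mul_zero, mul_zero]
    have h2 : baseCovector e ∘ₗ (torusElt e t : V →ₗ[K] V) = (a : K) • baseCovector e := by
      refine e.ext fun i => ?_
      rw [LinearMap.comp_apply, torusElt_apply_basis, map_smul, LinearMap.smul_apply,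
        baseCovector_apply, ht]
      split_ifs <;> simp
    have h3 := hu.functional_apply (evalAt d k (baseForm e) (baseCovector e))
      (isUpperTriangular_torusElt e t)
    rw [evalAt_apply_symTensorRep, h1, h2, evalAt_smul_smul, diagChar_torusElt] at h3
    simp only [ht, prod_parity_pow] at h3
    exact (mul_right_cancel₀ hu.evalAt_base_ne_zero h3).symm
  have h2 : (2 : K) ≠ 0 := two_ne_zero
  have inj {p q : ℕ} (h : (2 : K) ^ p = 2 ^ q) : p = q := by
    refine Nat.pow_right_injective le_rfl (Nat.cast_injective (R := K) ?_)
    simpa using h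
  have h3 := key (Units.mk0 2 h2) 1
  have h4 := key 1 (Units.mk0 2 h2)
  simp only [Units.val_mk0, Units.val_one, one_pow, mul_one, one_mul, ← pow_add] at h3 h4
  exact ⟨inj h3, inj h4⟩

end BasePoint

/-! ### `Sym^d(⋀² V) ⊗ Sym^k V` as a quotient of a tensor power -/

section TensorQuotient

open Module
open scoped Pointwise

variable {K : Type*} [Field K] {V : Type*} [AddCommGroup V] [Module K V]

section SymMul

variable {W : Type*} [AddCommGroup W] [Module K W]

theorem prod_ι_mem_symPower (d : ℕ) (w : Fin d → W) :
    ∏ i, SymmetricAlgebra.ι K W (w i) ∈ symPower K W d := by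
  rw [Fin.prod_univ_def, ← List.ofFn_eq_map]
  refine Submodule.pow_subset_pow _ (Set.mem_pow.mpr ⟨fun i => ⟨_, w i, rfl⟩, rfl⟩)

variable (K W) in
/-- The product of `d` vectors in the `d`-th symmetric power. -/
def symMul (d : ℕ) : MultilinearMap K (fun _ : Fin d => W) (symPower K W d) :=
  ((MultilinearMap.mkPiAlgebra K (Fin d) (SymmetricAlgebra K W)).compLinearMap
    fun _ => SymmetricAlgebra.ι K W).codRestrict _ (prod_ι_mem_symPower d)

theorem symMul_coe (d : ℕ) (w : Fin d → W) :
    (symMul K W d w : SymmetricAlgebra K W) = ∏ i, SymmetricAlgebra.ι K W (w i) := rfl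

theorem symEval_symMul (d : ℕ) (ω : Dual K W) (w : Fin d → W) :
    symEval d ω (symMul K W d w) = ∏ i, ω (w i) := by
  change SymmetricAlgebra.lift ω (symMul K W d w : SymmetricAlgebra K W) = _
  rw [symMul_coe, map_prod]
  simp

theorem symPowerRep_symMul {G : Type*} [Monoid G] (d : ℕ) (ρ : Representation K G W) (g : G)
    (w : Fin d → W) :
    symPowerRep d ρ g (symMul K W d w) = symMul K W d fun i => ρ g (w i) := by
  refine Subtype.ext ?_
  change symAlgMap (ρ g) (symMul K W d w : SymmetricAlgebra K W) = _
  rw [symMul_coe, symMul_coe, map_prod]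
  simp [symAlgMap]

theorem span_symMul (d : ℕ) {S : Set W} (hS : Submodule.span K S = ⊤) :
    Submodule.span K (Set.range fun w : Fin d → S => symMul K W d fun i => (w i : W)) = ⊤ := by
  have h1 : symPower K W d = Submodule.span K ((SymmetricAlgebra.ι K W '' S) ^ d) := by
    rw [symPower, ← Submodule.span_pow, ← Submodule.map_span, hS, Submodule.map_top]
  refine Submodule.map_injective_of_injective (symPower K W d).injective_subtype ?_
  rw [Submodule.map_span, Submodule.map_top, Submodule.range_subtype]
  refine Eq.trans ?_ h1.symm
  congr 1
  ext x
  rw [Set.mem_pow]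
  constructor
  · rintro ⟨_, ⟨w, rfl⟩, rfl⟩
    refine ⟨fun i => ⟨_, _, (w i).2, rfl⟩, ?_⟩
    rw [Submodule.subtype_apply, symMul_coe, Fin.prod_univ_def, ← List.ofFn_eq_map]
  · rintro ⟨f, rfl⟩
    choose w hw hwf using fun i => (f i).2
    refine ⟨_, ⟨fun i => ⟨w i, hw i⟩, rfl⟩, ?_⟩
    rw [Submodule.subtype_apply, symMul_coe, Fin.prod_univ_def, ← List.ofFn_eq_map]
    simp only [hwf]

end SymMul

variable (K V) in
/-- The multilinear map sending a family of pairs of vectors to the product of the wedge products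
of the pairs. -/
def wedgePairs (d : ℕ) :
    MultilinearMap K (fun _ : Fin d × Bool => V) (symPower K (⋀[K]^2 V) d) := by
  have h [DecidableEq (Fin d × Bool)] (v : Fin d × Bool → V) (p : Fin d × Bool) (x : V) :
      (fun i => wedge K V (Function.update v p x (i, false)) (Function.update v p x (i, true))) =
        Function.update (fun i => wedge K V (v (i, false)) (v (i, true))) p.1
          (if p.2 then wedge K V (v (p.1, false)) x else wedge K V x (v (p.1, true))) := by
    obtain ⟨i, b⟩ := p
    funext j
    by_cases hj : j = i
    · subst hj
      cases b <;> simp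
    · cases b <;> simp [hj]
  exact
    { toFun := fun v => symMul K (⋀[K]^2 V) d fun i => wedge K V (v (i, false)) (v (i, true))
      map_update_add' := fun v p x y => by
        rw [h, h, h, ← MultilinearMap.map_update_add]
        congr 2
        split_ifs <;> simp
      map_update_smul' := fun v p c x => by
        rw [h, h, ← MultilinearMap.map_update_smul]
        congr 2
        split_ifs <;> simp }

theorem wedgePairs_apply (d : ℕ) (v : Fin d × Bool → V) :
    wedgePairs K V d v =
      symMul K (⋀[K]^2 V) d fun i => wedge K V (v (i, false)) (v (i, true)) := rfl

variable (K V) in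
/-- The linear map underlying `mulMap`. -/
def mulTensor (d k : ℕ) : (⨂[K] _ : (Fin d × Bool) ⊕ Fin k, V) →ₗ[K]
    symPower K (⋀[K]^2 V) d ⊗[K] symPower K V k :=
  PiTensorProduct.lift ((wedgePairs K V d).domCoprod (symMul K V k))

theorem mulTensor_tprod (d k : ℕ) (v : (Fin d × Bool) ⊕ Fin k → V) :
    mulTensor K V d k (PiTensorProduct.tprod K v) =
      wedgePairs K V d (fun p => v (Sum.inl p)) ⊗ₜ[K] symMul K V k fun j => v (Sum.inr j) := by
  rw [mulTensor, PiTensorProduct.lift.tprod]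
  rfl

theorem mulTensor_comm (d k : ℕ) (g : LinearMap.GeneralLinearGroup K V) :
    mulTensor K V d k ∘ₗ tensorRep K V _ g =
      symTensorRep K V d k g ∘ₗ mulTensor K V d k := by
  refine PiTensorProduct.ext (MultilinearMap.ext fun v => ?_)
  simp only [LinearMap.compMultilinearMap_apply, LinearMap.comp_apply, tensorRep_tprod,
    mulTensor_tprod, wedgePairs_apply]
  change _ = symPowerRep d (extPowerRep 2 (stdRep K V)) g _ ⊗ₜ[K] symPowerRep k (stdRep K V) g _
  rw [symPowerRep_symMul, symPowerRep_symMul]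
  congr 2
  funext i
  exact (map_wedge (g : V →ₗ[K] V) _ _).symm

variable (K V) in
/-- The equivariant map from the tensor power of `V` to `Sym^d(⋀² V) ⊗ Sym^k V` given by
multiplication. -/
def mulMap (d k : ℕ) : (tensorRep K V ((Fin d × Bool) ⊕ Fin k)).IntertwiningMap
    (symTensorRep K V d k) where
  toLinearMap := mulTensor K V d k
  isIntertwining' g := mulTensor_comm d k g

theorem mulMap_apply (d k : ℕ) (x) : mulMap K V d k x = mulTensor K V d k x := rfl

theorem span_wedge : Submodule.span K (Set.range fun p : V × V => wedge K V p.1 p.2) = ⊤ := by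
  rw [← exteriorPower.ιMulti_span K 2 V]
  congr 1
  ext x
  constructor
  · rintro ⟨p, rfl⟩
    exact ⟨_, rfl⟩
  · rintro ⟨v, rfl⟩
    refine ⟨(v 0, v 1), ?_⟩
    simp only [wedge_apply]
    congr 1
    funext i
    fin_cases i <;> rfl

theorem MultilinearMap.surjective_lift_domCoprod {ι₁ ι₂ N₁ N₂ : Type*} [AddCommGroup N₁]
    [Module K N₁] [AddCommGroup N₂] [Module K N₂]
    (f : MultilinearMap K (fun _ : ι₁ => V) N₁) (g : MultilinearMap K (fun _ : ι₂ => V) N₂)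
    (hf : Submodule.span K (Set.range f) = ⊤) (hg : Submodule.span K (Set.range g) = ⊤) :
    Function.Surjective (PiTensorProduct.lift (f.domCoprod g)) := by
  rw [← LinearMap.range_eq_top, eq_top_iff, ← TensorProduct.map₂_mk_top_top_eq_top, ← hf, ← hg,
    Submodule.map₂_span_span, Submodule.span_le]
  rintro _ ⟨_, ⟨v, rfl⟩, _, ⟨w, rfl⟩, rfl⟩
  refine ⟨PiTensorProduct.tprod K (Sum.elim v w), ?_⟩
  rw [PiTensorProduct.lift.tprod]
  rfl

theorem span_range_symMul (d : ℕ) {W : Type*} [AddCommGroup W] [Module K W] :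
    Submodule.span K (Set.range (symMul K W d)) = ⊤ := by
  rw [eq_top_iff, ← span_symMul d (Submodule.span_univ (R := K) (M := W)), Submodule.span_le]
  rintro _ ⟨w, rfl⟩
  exact Submodule.subset_span ⟨_, rfl⟩

theorem span_range_wedgePairs (d : ℕ) :
    Submodule.span K (Set.range (wedgePairs K V d)) = ⊤ := by
  rw [eq_top_iff, ← span_symMul d (span_wedge (K := K) (V := V)), Submodule.span_le]
  rintro _ ⟨w, rfl⟩
  choose p hp using fun i => (w i).2
  refine Submodule.subset_span ⟨fun q => if q.2 then (p q.1).2 else (p q.1).1, ?_⟩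
  rw [wedgePairs_apply]
  simp [hp]

theorem mulMap_surjective (d k : ℕ) : Function.Surjective (mulMap K V d k) :=
  MultilinearMap.surjective_lift_domCoprod _ _ (span_range_wedgePairs d) (span_range_symMul k)

theorem evalAt_mulMap_tprod (d k : ℕ) (ω : Dual K (⋀[K]^2 V)) (ξ : Dual K V)
    (v : (Fin d × Bool) ⊕ Fin k → V) :
    evalAt d k ω ξ (mulMap K V d k (PiTensorProduct.tprod K v)) =
      (∏ i, ω (wedge K V (v (Sum.inl (i, false))) (v (Sum.inl (i, true))))) *
        ∏ j, ξ (v (Sum.inr j)) := by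
  rw [mulMap_apply, mulTensor_tprod, wedgePairs_apply]
  change symEval d ω _ * symEval k ξ _ = _
  rw [symEval_symMul, symEval_symMul]

end TensorQuotient

/-! ### Pairing the cells of a diagram -/

section CellPairing

variable {n d k : ℕ} {lam : Fin (2 * n) → ℕ}

theorem Cell.ext_val {m : ℕ} {lam : Fin m → ℕ} {c c' : Cell lam} (h1 : c.1 = c'.1)
    (h2 : (c.2 : ℕ) = c'.2) : c = c' := by
  obtain ⟨i, j⟩ := c
  obtain ⟨i', j'⟩ := c'
  obtain rfl : i = i' := h1
  obtain rfl : j = j' := Fin.ext h2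
  rfl

/-- An enumeration of the cells of a diagram which divides them into vertical dominoes, with upper
cells in the even rows, and single cells in the even rows, at most one of them in each column. -/
structure IsCellPairing (Θ : (Fin d × Bool) ⊕ Fin k ≃ Cell lam) : Prop where
  row_inl : ∀ i b, ((Θ (Sum.inl (i, b))).1 : ℕ) % 2 = if b then 1 else 0
  partner_row : ∀ i, (Θ (Sum.inl (i, true))).1 = partner (Θ (Sum.inl (i, false))).1
  col_eq : ∀ i, ((Θ (Sum.inl (i, true))).2 : ℕ) = (Θ (Sum.inl (i, false))).2
  row_inr : ∀ j, ((Θ (Sum.inr j)).1 : ℕ) % 2 = 0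
  col_inr : ∀ j j', ((Θ (Sum.inr j)).2 : ℕ) = (Θ (Sum.inr j')).2 → j = j'

theorem evenPart_le_oddPart (hlam : Antitone lam) (i : Fin n) : evenPart lam i ≤ oddPart lam i :=
  hlam (Fin.mk_le_mk.mpr (Nat.le_succ _))

theorem oddPart_le_evenPart (hlam : Antitone lam) {i j : Fin n} (h : i < j) :
    oddPart lam j ≤ evenPart lam i := by
  have h' : (i : ℕ) < j := h
  exact hlam (Fin.mk_le_mk.mpr (by omega))

/-- The `evenPart lam i` leftmost cells of the rows `2i` and `2i + 1` form the dominoes, and the other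
`oddPart lam i - evenPart lam i` cells of the row `2i` are the single cells. -/
theorem exists_isCellPairing (hlam : Antitone lam) (ho : ∑ i, oddPart lam i = d + k)
    (he : ∑ i, evenPart lam i = d) :
    ∃ Θ : (Fin d × Bool) ⊕ Fin k ≃ Cell lam, IsCellPairing Θ := by
  have hle := evenPart_le_oddPart hlam
  have hcα : Fintype.card (Fin d) = Fintype.card (Σ i : Fin n, Fin (evenPart lam i)) := by
    simp [he]
  have hcβ : Fintype.card (Fin k) =
      Fintype.card (Σ i : Fin n, Fin (oddPart lam i - evenPart lam i)) := by
    simp [Finset.sum_tsub_distrib _ fun i _ => hle i, ho, he]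
  set α := Fintype.equivOfCardEq hcα
  set β := Fintype.equivOfCardEq hcβ
  set f : (Fin d × Bool) ⊕ Fin k → Cell lam := Sum.elim
    (fun p => if p.2 then ⟨⟨2 * (α p.1).1 + 1, by omega⟩, (α p.1).2⟩
      else ⟨⟨2 * (α p.1).1, by omega⟩, ⟨(α p.1).2, (α p.1).2.2.trans_le (hle _)⟩⟩)
    fun j => ⟨⟨2 * (β j).1, by omega⟩, ⟨evenPart lam (β j).1 + (β j).2, by
      have h1 := (β j).2.2
      have h2 := hle (β j).1
      change _ < oddPart lam (β j).1
      omega⟩⟩ with hf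
  have hα {i i' : Fin d} (h1 : ((α i).1 : ℕ) = (α i').1) (h2 : ((α i).2 : ℕ) = (α i').2) :
      i = i' := α.injective (Cell.ext_val (Fin.ext h1) h2)
  have hβ {j j' : Fin k} (h1 : (β j).1 = (β j').1)
      (h2 : evenPart lam (β j).1 + (β j).2 = evenPart lam (β j').1 + (β j').2) : j = j' := by
    have h3 := congrArg (evenPart lam) h1
    exact β.injective (Cell.ext_val h1 (by omega))
  have hαβ {i : Fin d} {j : Fin k} (h1 : ((α i).1 : ℕ) = (β j).1)
      (h2 : ((α i).2 : ℕ) = evenPart lam (β j).1 + (β j).2) : False := by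
    have h3 := (α i).2.2
    have h4 : evenPart lam (α i).1 = evenPart lam (β j).1 := congrArg _ (Fin.ext h1)
    omega
  have hinj : Function.Injective f := by
    rintro (⟨i, b⟩ | j) (⟨i', b'⟩ | j') h
    all_goals
      have h1 : ((f _).1 : ℕ) = (f _).1 := congrArg (fun c : Cell lam => (c.1 : ℕ)) h
      have h2 : ((f _).2 : ℕ) = (f _).2 := congrArg (fun c : Cell lam => (c.2 : ℕ)) h
    · cases b <;> cases b' <;> simp [hf] at h1 h2
      · rw [hα h1 h2]
      · omega
      · omega
      · rw [hα h1 h2]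
    · cases b <;> simp [hf] at h1 h2
      · exact (hαβ h1 h2).elim
      · omega
    · cases b' <;> simp [hf] at h1 h2
      · exact (hαβ h1.symm h2.symm).elim
      · omega
    · simp [hf] at h1 h2
      rw [hβ (Fin.ext h1) h2]
  have hcard : Fintype.card ((Fin d × Bool) ⊕ Fin k) = Fintype.card (Cell lam) := by
    have h : ∑ i, lam i = d + k + d := by
      rw [sum_fin_two_mul lam, Finset.sum_add_distrib]
      exact congrArg₂ (· + ·) ho he
    simp [h]
    omega
  refine ⟨Equiv.ofBijective f ((Fintype.bijective_iff_injective_and_card f).mpr ⟨hinj, hcard⟩),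
    fun i b => ?_, fun i => Fin.ext ?_, fun i => ?_, fun j => ?_, fun j j' h => ?_⟩
  · cases b <;> simp [hf]
  · simp [hf, partner_val]
  · rfl
  · simp [hf]
  · change evenPart lam (β j).1 + (β j).2 = evenPart lam (β j').1 + (β j').2 at h
    have hcol (j : Fin k) : evenPart lam (β j).1 + (β j).2 < oddPart lam (β j).1 := by
      have h1 := (β j).2.2
      omega
    rcases lt_trichotomy (β j).1 (β j').1 with hlt | heq | hlt
    · have h1 := oddPart_le_evenPart hlam hlt
      have h2 := hcol j'
      omega
    · exact hβ heq h
    · have h1 := oddPart_le_evenPart hlam hlt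
      have h2 := hcol j
      omega

/-- A column preserving permutation that maps the dominoes to pairs of cells in partner rows
permutes the dominoes, up to flips, and fixes the single cells. -/
theorem IsCellPairing.exists_perm {Θ : (Fin d × Bool) ⊕ Fin k ≃ Cell lam} (hΘ : IsCellPairing Θ)
    (q : Equiv.Perm (Cell lam)) (hq : ∀ c, ((q c).2 : ℕ) = c.2)
    (h : ∀ i, (q (Θ (Sum.inl (i, true)))).1 = partner (q (Θ (Sum.inl (i, false)))).1) :
    ∃ σ : Equiv.Perm (Fin d),
      (∀ i b, q (Θ (Sum.inl (i, b))) = Θ (Sum.inl (σ i,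
        xor b (decide (((q (Θ (Sum.inl (i, false)))).1 : ℕ) % 2 = 1))))) ∧
      ∀ j, q (Θ (Sum.inr j)) = Θ (Sum.inr j) := by
  have hpar (i : Fin (2 * n)) : ((partner i : Fin (2 * n)) : ℕ) % 2 = 1 - (i : ℕ) % 2 := by
    rw [partner_val]
    split_ifs <;> omega
  -- a cell in an odd row is the lower half of a domino
  have hodd (c : Cell lam) (hc : (c.1 : ℕ) % 2 = 1) : ∃ i, c = Θ (Sum.inl (i, true)) := by
    obtain ⟨x, rfl⟩ := Θ.surjective c
    rcases x with ⟨i, b⟩ | j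
    · have h1 := hΘ.row_inl i b
      cases b
      · simp at h1
        omega
      · exact ⟨i, rfl⟩
    · have h1 := hΘ.row_inr j
      omega
  have hpair (c c' : Cell lam) (hc : (c.1 : ℕ) % 2 = 1) (hrow : c'.1 = partner c.1)
      (hcol : (c'.2 : ℕ) = c.2) :
      ∃ i, c = Θ (Sum.inl (i, true)) ∧ c' = Θ (Sum.inl (i, false)) := by
    obtain ⟨i, rfl⟩ := hodd c hc
    refine ⟨i, rfl, Cell.ext_val ?_ (hcol.trans (hΘ.col_eq i))⟩
    rw [hrow, hΘ.partner_row, partner_partner]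
  have hcols (i) : ((q (Θ (Sum.inl (i, true)))).2 : ℕ) = (q (Θ (Sum.inl (i, false)))).2 := by
    rw [hq, hq, hΘ.col_eq]
  have key (i) : ∃ i', ∀ b, q (Θ (Sum.inl (i, b))) = Θ (Sum.inl (i',
      xor b (decide (((q (Θ (Sum.inl (i, false)))).1 : ℕ) % 2 = 1)))) := by
    by_cases hi : ((q (Θ (Sum.inl (i, false)))).1 : ℕ) % 2 = 1
    · obtain ⟨i', h1, h2⟩ := hpair _ _ hi (h i) (hcols i)
      refine ⟨i', fun b => ?_⟩
      rw [decide_eq_true hi]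
      cases b
      · exact h1
      · exact h2
    · obtain ⟨i', h1, h2⟩ := hpair (q (Θ (Sum.inl (i, true)))) (q (Θ (Sum.inl (i, false))))
        (by rw [h i, hpar]; omega) (by rw [h i, partner_partner]) (hcols i).symm
      refine ⟨i', fun b => ?_⟩
      rw [decide_eq_false hi]
      cases b
      · exact h2
      · exact h1
  choose σ hσ using key
  have hinl (i b) : ∃ p, q (Θ (Sum.inl p)) = Θ (Sum.inl (i, b)) := by
    set F : Fin d × Bool → Fin d × Bool := fun p =>
      (σ p.1, xor p.2 (decide (((q (Θ (Sum.inl (p.1, false)))).1 : ℕ) % 2 = 1)))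
    have hF (p) : q (Θ (Sum.inl p)) = Θ (Sum.inl (F p)) := hσ p.1 p.2
    have hinj : Function.Injective F := fun p p' hpp => by
      have := (hF p).trans ((congrArg (fun x => Θ (Sum.inl x)) hpp).trans (hF p').symm)
      exact Sum.inl_injective (Θ.injective (q.injective this))
    obtain ⟨p, hp⟩ := (Finite.injective_iff_surjective.mp hinj) (i, b)
    exact ⟨p, (hF p).trans (by rw [hp])⟩
  have hsurj : Function.Surjective σ := fun i => by
    obtain ⟨p, hp⟩ := hinl i true
    have h1 := (hσ p.1 p.2).symm.trans hp
    exact ⟨p.1, congrArg Prod.fst (Sum.inl_injective (Θ.injective h1))⟩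
  refine ⟨Equiv.ofBijective σ ⟨Finite.injective_iff_surjective.mpr hsurj, hsurj⟩, hσ, fun j => ?_⟩
  obtain ⟨x, hx⟩ := Θ.surjective (q (Θ (Sum.inr j)))
  rcases x with ⟨i, b⟩ | j'
  · obtain ⟨p, hp⟩ := hinl i b
    exact absurd (Θ.injective (q.injective (hp.trans hx))) Sum.inl_ne_inr
  · rw [← hx, hΘ.col_inr j' j (by rw [hx, hq])]

/-- Permuting the dominoes is an even permutation of the cells, so only the flips contribute to the
sign. -/
theorem IsCellPairing.sign_eq {Θ : (Fin d × Bool) ⊕ Fin k ≃ Cell lam} (hΘ : IsCellPairing Θ)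
    (q : Equiv.Perm (Cell lam)) (hq : ∀ c, ((q c).2 : ℕ) = c.2)
    (h : ∀ i, (q (Θ (Sum.inl (i, true)))).1 = partner (q (Θ (Sum.inl (i, false)))).1) :
    Equiv.Perm.sign q =
      ∏ i, if ((q (Θ (Sum.inl (i, false)))).1 : ℕ) % 2 = 0 then 1 else -1 := by
  obtain ⟨σ, hσ, hfix⟩ := hΘ.exists_perm q hq h
  set ε : Fin d → Prop := fun i => ((q (Θ (Sum.inl (i, false)))).1 : ℕ) % 2 = 0 with hε
  have hq' : (Θ.trans q).trans Θ.symm = Equiv.sumCongr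
      ((Equiv.prodCongrRight fun i => if ε i then 1 else Equiv.swap false true).trans
        (Equiv.prodCongrLeft fun _ : Bool => σ)) (1 : Equiv.Perm (Fin k)) := by
    refine Equiv.ext fun x => ?_
    rw [Equiv.trans_apply, Equiv.trans_apply, Equiv.symm_apply_eq]
    rcases x with ⟨i, b⟩ | j
    · rw [hσ]
      refine congrArg (fun x => Θ (Sum.inl x)) (Prod.ext rfl ?_)
      change _ = (if ε i then 1 else Equiv.swap false true : Equiv.Perm Bool) b
      by_cases hi : ε i
      · have hi' : ¬ ((q (Θ (Sum.inl (i, false)))).1 : ℕ) % 2 = 1 := by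
          simp only [hε] at hi
          omega
        rw [if_pos hi, decide_eq_false hi']
        cases b <;> rfl
      · have hi' : ((q (Θ (Sum.inl (i, false)))).1 : ℕ) % 2 = 1 := by
          simp only [hε] at hi
          omega
        rw [if_neg hi, decide_eq_true hi']
        cases b <;> rfl
    · exact hfix j
  rw [← Equiv.Perm.sign_trans_trans_symm q Θ, hq', Equiv.Perm.sign_sumCongr,
    Equiv.Perm.sign_trans, Equiv.Perm.sign_prodCongrRight, Equiv.Perm.sign_prodCongrLeft]
  simp only [Equiv.Perm.sign_one, mul_one, Finset.prod_const, Finset.card_univ, Fintype.card_bool,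
    Int.units_sq, one_mul]
  refine Finset.prod_congr rfl fun i _ => ?_
  by_cases hi : ε i
  · rw [if_pos hi, Equiv.Perm.sign_one]
    exact (if_pos hi).symm
  · rw [if_neg hi, Equiv.Perm.sign_swap (by decide)]
    exact (if_neg hi).symm

end CellPairing

/-! ### The constituents of `Sym^d(⋀² V) ⊗ Sym^k V` -/

section Constituents

open Module

variable {K : Type*} [Field K] {V : Type*} [AddCommGroup V] [Module K V]
  {n d k : ℕ} {lam : Fin (2 * n) → ℕ}

variable (K V) in
/-- The intertwining map from `V^lam` to `Sym^d(⋀² V) ⊗ Sym^k V` attached to an enumeration of the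
cells of `lam`: the tensor factors are multiplied according to the enumeration. -/
def schurToSymTensor (Θ : (Fin d × Bool) ⊕ Fin k ≃ Cell lam) :
    (schurRep lam (stdRep K V)).IntertwiningMap (symTensorRep K V d k) where
  toLinearMap := mulTensor K V d k ∘ₗ
    (PiTensorProduct.reindex K (fun _ : Cell lam => V) Θ.symm).toLinearMap ∘ₗ
      (schurSubmodule K V lam).subtype
  isIntertwining' g := by
    refine LinearMap.ext fun x => ?_
    have h1 := LinearMap.congr_fun (PiTensorProduct.map_comp_reindex_eq
      (fun _ : Cell lam => stdRep K V g) Θ.symm) (x : CellTensor K V lam)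
    have h2 := LinearMap.congr_fun (mulTensor_comm (V := V) d k g)
      (PiTensorProduct.reindex K (fun _ : Cell lam => V) Θ.symm x)
    exact (congrArg (mulTensor K V d k) h1.symm).trans h2

/-- Evaluation at the base point after multiplying the tensor factors according to an enumeration
of the cells. -/
def cellEval (e : Basis (Fin (2 * n)) K V) (Θ : (Fin d × Bool) ⊕ Fin k ≃ Cell lam) :
    CellTensor K V lam →ₗ[K] K :=
  evalAt d k (baseForm e) (baseCovector e) ∘ₗ mulTensor K V d k ∘ₗ
    (PiTensorProduct.reindex K (fun _ : Cell lam => V) Θ.symm).toLinearMap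

theorem cellEval_tprod (e : Basis (Fin (2 * n)) K V) (Θ : (Fin d × Bool) ⊕ Fin k ≃ Cell lam)
    (v : Cell lam → V) :
    cellEval e Θ (PiTensorProduct.tprod K v) =
      (∏ i, baseForm e (wedge K V (v (Θ (Sum.inl (i, false)))) (v (Θ (Sum.inl (i, true)))))) *
        ∏ j, baseCovector e (v (Θ (Sum.inr j))) := by
  change evalAt d k (baseForm e) (baseCovector e) (mulMap K V d k
    (PiTensorProduct.reindex K (fun _ : Cell lam => V) Θ.symm (PiTensorProduct.tprod K v))) = _
  rw [PiTensorProduct.reindex_tprod, evalAt_mulMap_tprod]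
  rfl

/-- The column preserving permutations contribute `0` or `1`, without sign, to the value at the base
point of the image of the highest weight vector. -/
theorem sign_mul_cellEval (e : Basis (Fin (2 * n)) K V)
    {Θ : (Fin d × Bool) ⊕ Fin k ≃ Cell lam} (hΘ : IsCellPairing Θ)
    (q : Equiv.Perm (Cell lam)) (hq : ∀ c, ((q c).2 : ℕ) = c.2) :
    ((Equiv.Perm.sign q : ℤ) : K) *
        cellEval e Θ (PiTensorProduct.tprod K fun c => e (q c).1) =
      if ∀ i, (q (Θ (Sum.inl (i, true)))).1 = partner (q (Θ (Sum.inl (i, false)))).1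
        then 1 else 0 := by
  rw [cellEval_tprod]
  simp only [baseForm_wedge, baseCovector_apply]
  split_ifs with h
  · obtain ⟨σ, hσ, hfix⟩ := hΘ.exists_perm q hq h
    have h1 : ∏ j, (if ((q (Θ (Sum.inr j))).1 : ℕ) % 2 = 0 then (1 : K) else 0) = 1 :=
      Finset.prod_eq_one fun j _ => by rw [hfix, if_pos (hΘ.row_inr j)]
    rw [h1, mul_one, hΘ.sign_eq q hq h]
    simp only [h, if_true]
    push_cast
    rw [← Finset.prod_mul_distrib]
    refine Finset.prod_eq_one fun i _ => ?_
    split_ifs <;> simp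
  · push Not at h
    obtain ⟨i, hi⟩ := h
    rw [Finset.prod_eq_zero (Finset.mem_univ i) (if_neg hi), zero_mul, mul_zero]

open Classical in
theorem map_colAntisymmetrizer_tprod (L : CellTensor K V lam →ₗ[K] K) (v : Cell lam → V) :
    L (colAntisymmetrizer K V lam (PiTensorProduct.tprod K v)) =
      ∑ q : Equiv.Perm (Cell lam) with ∀ c, ((q c).2 : ℕ) = (c.2 : ℕ),
        ((Equiv.Perm.sign q : ℤ) : K) * L (PiTensorProduct.tprod K fun c => v (q⁻¹ c)) := by
  rw [colAntisymmetrizer, LinearMap.sum_apply, map_sum]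
  refine Finset.sum_congr (by congr!) fun q _ => ?_
  rw [LinearMap.smul_apply, map_smul, smul_eq_mul]
  exact congrArg (fun x => ((Equiv.Perm.sign q : ℤ) : K) * L x) (permRep_tprod q v)

theorem cellEval_schurVec_ne_zero [CharZero K] (e : Basis (Fin (2 * n)) K V)
    {Θ : (Fin d × Bool) ⊕ Fin k ≃ Cell lam} (hΘ : IsCellPairing Θ) :
    cellEval e Θ (schurVec lam e : CellTensor K V lam) ≠ 0 := by
  classical
  obtain ⟨N, hN, hrow⟩ := rowSymmetrizer_basis_fst (K := K) (V := V) (lam := lam) e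
  rw [schurVec, schurProj_coe, hrow, map_smul, map_smul, Basis.piTensorProduct_apply,
    map_colAntisymmetrizer_tprod]
  refine smul_ne_zero hN ?_
  -- the summands are all `0` or `1`, and the summand of the identity is `1`
  have hterm : ∀ q ∈ Finset.univ.filter fun s : Equiv.Perm (Cell lam) =>
      ∀ c, ((s c).2 : ℕ) = (c.2 : ℕ),
      ((Equiv.Perm.sign q : ℤ) : K) *
          cellEval e Θ (PiTensorProduct.tprod K fun c => e (q⁻¹ c).1) =
        if ∀ i, (q⁻¹ (Θ (Sum.inl (i, true)))).1 = partner (q⁻¹ (Θ (Sum.inl (i, false)))).1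
          then 1 else 0 := fun q hq => by
    have hq' : ∀ c, (((q⁻¹ : Equiv.Perm (Cell lam)) c).2 : ℕ) = c.2 := fun c => by
      rw [← (Finset.mem_filter.mp hq).2, Equiv.Perm.apply_inv_apply]
    rw [← sign_mul_cellEval e hΘ q⁻¹ hq', Equiv.Perm.sign_inv]
  rw [Finset.sum_congr (by congr!) hterm, Finset.sum_boole]
  refine Nat.cast_ne_zero.mpr (Finset.card_ne_zero.mpr ⟨1, ?_⟩)
  refine Finset.mem_filter.mpr ⟨Finset.mem_filter.mpr ⟨Finset.mem_univ _, fun c => rfl⟩, fun i => ?_⟩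
  exact hΘ.partner_row i

theorem schurToSymTensor_schurVec_ne_zero [CharZero K] (e : Basis (Fin (2 * n)) K V)
    {Θ : (Fin d × Bool) ⊕ Fin k ≃ Cell lam} (hΘ : IsCellPairing Θ) :
    schurToSymTensor K V Θ (schurVec lam e) ≠ 0 := fun h0 =>
  cellEval_schurVec_ne_zero e hΘ
    ((congrArg (evalAt d k (baseForm e) (baseCovector e)) h0).trans (LinearMap.map_zero _))

end Constituents

/-! ### Decomposition of a representation by its highest weight vectors -/

section Decomposition

open Module

theorem Representation.IntertwiningMap.exists_leftInverse_of_isSemisimple {K G E F : Type*}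
    [Field K] [Monoid G] [AddCommGroup E] [Module K E] [AddCommGroup F] [Module K F]
    {ρ : Representation K G E} {σ : Representation K G F}
    (hσ : σ.IsSemisimpleRepresentation) (f : ρ.IntertwiningMap σ) (hf : Function.Injective f) :
    ∃ p : σ.IntertwiningMap ρ, ∀ x, p (f x) = x := by
  rw [Representation.isSemisimpleRepresentation_iff_isSemisimpleModule_asModule] at hσ
  obtain ⟨h, hh⟩ := IsSemisimpleModule.extension_property
    (Representation.IntertwiningMap.equivLinearMapAsModule _ _ f) hf LinearMap.id
  exact ⟨(Representation.IntertwiningMap.equivLinearMapAsModule _ _).symm h,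
    fun x => LinearMap.congr_fun hh x⟩

section DirectSum

variable {K G I : Type*} [Field K] [Monoid G] {W : I → Type*} [∀ i, AddCommGroup (W i)]
  [∀ i, Module K (W i)] {E : Type*} [AddCommGroup E] [Module K E]
  {ρ : ∀ i, Representation K G (W i)} {σ : Representation K G E}

open Classical in
/-- The intertwining map from a direct sum with given restrictions to the summands. -/
def directSumMap (f : ∀ i, (ρ i).IntertwiningMap σ) :
    (Representation.directSum ρ).IntertwiningMap σ where
  toLinearMap := DirectSum.toModule K I E fun i => (f i).toLinearMap
  isIntertwining' g := by
    refine DirectSum.linearMap_ext K fun i => LinearMap.ext fun x => ?_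
    simp only [LinearMap.comp_apply, Representation.directSum, MonoidHom.coe_mk, OneHom.coe_mk,
      DirectSum.lmap_lof, DirectSum.toModule_lof]
    exact LinearMap.congr_fun ((f i).isIntertwining' g) x

open Classical in
theorem directSumMap_lof (f : ∀ i, (ρ i).IntertwiningMap σ) (i : I) (x : W i) :
    directSumMap f (DirectSum.lof K I W i x) = f i x :=
  DirectSum.toModule_lof K i x

/-- Nonzero maps from pairwise non-isomorphic irreducible representations to a completely reducible
representation are independent. -/
theorem directSumMap_injective (hσ : σ.IsSemisimpleRepresentation)
    (hirr : ∀ i, (ρ i).IsIrreducible) (hiso : ∀ i j, Nonempty ((ρ i).Equiv (ρ j)) → i = j)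
    (f : ∀ i, (ρ i).IntertwiningMap σ) (hf : ∀ i, f i ≠ 0) :
    Function.Injective (directSumMap f) := by
  classical
  have hinj (i) : Function.Injective (f i) := by
    have := hirr i
    exact (Representation.IsIrreducible.injective_or_eq_zero (f i)).resolve_right (hf i)
  -- retractions of the `f i`; by Schur's lemma they vanish on the other summands
  choose p hp using fun i => (f i).exists_leftInverse_of_isSemisimple hσ (hinj i)
  have hpf (i j : I) (hne : j ≠ i) (x : W j) : p i (f j x) = 0 := by
    have h1 := hirr i
    have h2 := hirr j
    rcases Representation.IsIrreducible.bijective_or_eq_zero ((p i).comp (f j)) with h | h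
    · exact absurd (hiso j i ⟨Representation.IntertwiningMap.ofBijective _ h⟩) hne
    · exact congrArg (fun φ : (ρ j).IntertwiningMap (ρ i) => φ x) h
  have hcomp (i : I) : (p i).toLinearMap ∘ₗ (directSumMap f).toLinearMap =
      DirectSum.component K I W i := by
    refine DirectSum.linearMap_ext K fun j => LinearMap.ext fun x => ?_
    change p i (directSumMap f _) = DirectSum.component K I _ i (DirectSum.lof K I _ j x)
    rw [directSumMap_lof]
    by_cases h : j = i
    · subst h
      rw [hp, DirectSum.component.lof_self]
    · rw [hpf i j h, DirectSum.component.of, dif_neg h]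
  refine (injective_iff_map_eq_zero (directSumMap f)).mpr fun x hx => DFinsupp.ext fun i => ?_
  refine (LinearMap.congr_fun (hcomp i) x).symm.trans ?_
  change p i (directSumMap f x) = 0
  rw [hx, map_zero]

end DirectSum

variable {K : Type*} [Field K] [CharZero K] {V : Type*} [AddCommGroup V] [Module K V]
  [FiniteDimensional K V] {m : ℕ} {ι : Type*} [Fintype ι] {E : Type*} [AddCommGroup E] [Module K E]
  {σ : Representation K (LinearMap.GeneralLinearGroup K V) E}

/-- A map to a homomorphic image of a tensor power of `V` is surjective if it hits a highest weight
vector of each weight that occurs, these being unique up to scalars. -/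
theorem surjective_of_highestWeightVector {F : Type*} [AddCommGroup F] [Module K F]
    {τ : Representation K (LinearMap.GeneralLinearGroup K V) F} (e : Basis (Fin m) K V)
    (π : (tensorRep K V ι).IntertwiningMap σ) (hπ : Function.Surjective π)
    (huniq : ∀ lam u u', IsHighestWeightVector e σ lam u → IsHighestWeightVector e σ lam u' →
      ∃ c : K, u' = c • u)
    (f : τ.IntertwiningMap σ) (hf : ∀ lam u, Antitone lam → IsHighestWeightVector e σ lam u →
      ∃ x, IsHighestWeightVector e σ lam (f x)) : Function.Surjective f := by
  have hss : σ.IsSemisimpleRepresentation :=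
    isSemisimple_of_surjective (isSemisimple_tensorRep ι) π hπ
  obtain ⟨C, hC⟩ := hss.exists_isCompl f.range
  have hC' := (isCompl_toSubmodule_iff f.range C).mpr hC
  suffices hbot : C = ⊥ by
    have htop : f.range = ⊤ := by simpa [hbot] using hC.sup_eq_top
    intro y
    have hy : y ∈ (⊤ : Subrepresentation σ).toSubmodule := Submodule.mem_top
    rw [← htop] at hy
    exact hy
  by_contra hne
  obtain ⟨lam, u, hlam, huC, hu⟩ := exists_isHighestWeightVector e π hπ C hne
  obtain ⟨x, hx⟩ := hf lam u hlam hu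
  obtain ⟨c, hc⟩ := huniq lam _ u hx hu
  refine hu.ne_zero (Submodule.disjoint_def.mp hC'.disjoint u ?_ huC)
  rw [hc]
  exact f.range.toSubmodule.smul_mem c ⟨x, rfl⟩

/-- A homomorphic image of a tensor power of `V` whose highest weight vectors of given weight are
unique up to scalars is the direct sum of pairwise non-isomorphic irreducible representations,
provided that it receives from each of them a map which does not kill a highest weight vector, and
that the weights of these vectors are all the weights of its highest weight vectors. -/
theorem nonempty_equiv_directSum {I : Type*} {W : I → Type*} [∀ i, AddCommGroup (W i)]
    [∀ i, Module K (W i)] {ρ : ∀ i, Representation K (LinearMap.GeneralLinearGroup K V) (W i)}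
    (hirr : ∀ i, (ρ i).IsIrreducible) (hiso : ∀ i j, Nonempty ((ρ i).Equiv (ρ j)) → i = j)
    (e : Basis (Fin m) K V)
    (π : (tensorRep K V ι).IntertwiningMap σ) (hπ : Function.Surjective π)
    (huniq : ∀ lam u u', IsHighestWeightVector e σ lam u → IsHighestWeightVector e σ lam u' →
      ∃ c : K, u' = c • u)
    {wt : I → Fin m → ℕ} {v : ∀ i, W i} (hv : ∀ i, IsHighestWeightVector e (ρ i) (wt i) (v i))
    (hwt : ∀ lam u, Antitone lam → IsHighestWeightVector e σ lam u → ∃ i, wt i = lam)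
    (hf : ∀ i, ∃ f : (ρ i).IntertwiningMap σ, f (v i) ≠ 0) :
    Nonempty (σ.Equiv (Representation.directSum ρ)) := by
  classical
  choose f hf using hf
  have hinj : Function.Injective (directSumMap f) :=
    directSumMap_injective (isSemisimple_of_surjective (isSemisimple_tensorRep ι) π hπ) hirr hiso
      f fun i h => hf i (by rw [h]; rfl)
  have hsurj : Function.Surjective (directSumMap f) :=
    surjective_of_highestWeightVector e π hπ huniq _ fun lam u hlam hu => by
      obtain ⟨i, rfl⟩ := hwt lam u hlam hu
      refine ⟨DirectSum.lof K I W i (v i), ?_⟩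
      rw [directSumMap_lof]
      exact (hv i).map _ (hf i)
  exact ⟨((directSumMap f).ofBijective ⟨hinj, hsurj⟩).symm⟩

/-- A homomorphic image of a tensor power of `V` whose highest weight vectors of given weight are
unique up to scalars is multiplicity free. -/
theorem isMultiplicityFree_of_highestWeightVector (e : Basis (Fin m) K V)
    (π : (tensorRep K V ι).IntertwiningMap σ) (hπ : Function.Surjective π)
    (huniq : ∀ lam u u', IsHighestWeightVector e σ lam u → IsHighestWeightVector e σ lam u' →
      ∃ c : K, u' = c • u) : IsMultiplicityFree σ := by
  refine ⟨isSemisimple_of_surjective (isSemisimple_tensorRep ι) π hπ, fun U _ _ τ hτ => ?_⟩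
  rw [rank_le_one_iff]
  by_cases h : ∀ φ : τ.IntertwiningMap σ, φ = 0
  · exact ⟨0, fun φ => ⟨0, by rw [h φ, smul_zero]⟩⟩
  push Not at h
  obtain ⟨φ, hφ⟩ := h
  have hinj : Function.Injective φ :=
    (Representation.IsIrreducible.injective_or_eq_zero φ).resolve_right hφ
  have hrange : φ.range ≠ ⊥ := fun h0 => hφ (DFunLike.ext _ _ fun x => by
    have hx : φ x ∈ φ.range.toSubmodule := ⟨x, rfl⟩
    rw [h0] at hx
    exact (Submodule.mem_bot K).mp hx)
  obtain ⟨lam, u, -, ⟨a, ha⟩, hu⟩ := exists_isHighestWeightVector e π hπ φ.range hrange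
  replace ha : φ a = u := ha
  subst ha
  have ha0 : a ≠ 0 := fun h0 => hu.ne_zero (by rw [h0, map_zero])
  have hsingle {ψ : τ.IntertwiningMap σ} (h0 : ψ a = 0) : ψ = 0 :=
    (Representation.IsIrreducible.injective_or_eq_zero ψ).resolve_left fun hψ =>
      ha0 (hψ (h0.trans (map_zero ψ).symm))
  refine ⟨φ, fun ψ => ?_⟩
  by_cases h0 : ψ a = 0
  · exact ⟨0, by rw [hsingle h0, zero_smul]⟩
  have hψ : IsHighestWeightVector e σ lam (ψ a) := by
    refine ⟨h0, fun g hg => ?_⟩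
    have h1 : τ g a = diagChar e lam (g : V →ₗ[K] V) • a := hinj (by
      rw [φ.isIntertwining, hu.apply_eq g hg, map_smul])
    rw [← ψ.isIntertwining, h1, map_smul]
  obtain ⟨c, hc⟩ := huniq lam _ _ hu hψ
  refine ⟨c, (sub_eq_zero.mp (hsingle ?_)).symm⟩
  change ψ a - c • φ a = 0
  rw [hc, sub_self]

end Decomposition

/-! ### The decomposition of `Sym^d(⋀² V) ⊗ Sym^k V` -/

theorem mem_weightIndex_iff {n d d' : ℕ} {lam : Fin (2 * n) → ℕ} :
    lam ∈ WeightIndex n d d' ↔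
      Antitone lam ∧ ∑ i, oddPart lam i = d' ∧ ∑ i, evenPart lam i = d := by
  constructor
  · exact fun h => ⟨h.1.1, h.2.1.2, h.2.2.2⟩
  · rintro ⟨h, ho, he⟩
    refine ⟨⟨h, ?_⟩, ⟨fun i j hij => h ?_, ho⟩, ⟨fun i j hij => h ?_, he⟩⟩
    · rw [sum_fin_two_mul lam, Finset.sum_add_distrib, add_comm]
      exact congrArg₂ (· + ·) he ho
    · have hij' : (i : ℕ) ≤ j := hij
      exact Fin.mk_le_mk.mpr (by omega)
    · have hij' : (i : ℕ) ≤ j := hij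
      exact Fin.mk_le_mk.mpr (by omega)

theorem lemma2p4p2 {K : Type*} [Field K] [IsAlgClosed K] [CharZero K]
    {V : Type*} [AddCommGroup V] [Module K V] [FiniteDimensional K V]
    (n d d' : ℕ) (hV : Module.finrank K V = 2 * n) (hd : d ≤ d') :
    Nonempty (Representation.Equiv
      ((symPowerRep d (extPowerRep 2 (stdRep K V))).tprod (symPowerRep (d' - d) (stdRep K V)))
      (Representation.directSum
        fun lam : WeightIndex n d d' => schurRep lam.1 (stdRep K V))) ∧
    (∀ lam ∈ WeightIndex n d d', (schurRep lam (stdRep K V)).IsIrreducible) ∧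
    (∀ lam ∈ WeightIndex n d d', ∀ mu ∈ WeightIndex n d d',
      Nonempty (Representation.Equiv (schurRep lam (stdRep K V)) (schurRep mu (stdRep K V))) →
        lam = mu) ∧
    IsMultiplicityFree (W := symPower K (⋀[K]^2 V) d ⊗[K] symPower K V (d' - d))
      ((symPowerRep d (extPowerRep 2 (stdRep K V))).tprod
        (symPowerRep (d' - d) (stdRep K V))) := by
  set e : Module.Basis (Fin (2 * n)) K V := Module.finBasisOfFinrankEq K V hV
  have hanti : ∀ lam ∈ WeightIndex n d d', Antitone lam := fun lam h => h.1.1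
  have huniq := fun (lam : Fin (2 * n) → ℕ)
    (u u' : symPower K (⋀[K]^2 V) d ⊗[K] symPower K V (d' - d))
    (hu : IsHighestWeightVector e (symTensorRep K V d (d' - d)) lam u)
    (hu' : IsHighestWeightVector e (symTensorRep K V d (d' - d)) lam u') =>
    IsHighestWeightVector.exists_eq_smul (K := K) (V := V) hu hu'
  refine ⟨?_, fun lam hlam => isIrreducible_schurRep e (hanti lam hlam),
    fun lam hlam mu hmu ⟨φ⟩ => eq_of_schurRep_equiv e (hanti lam hlam) (hanti mu hmu) φ,
    isMultiplicityFree_of_highestWeightVector e (mulMap K V d (d' - d)) (mulMap_surjective (K := K) (V := V) d (d' - d))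
      huniq⟩
  refine nonempty_equiv_directSum (ρ := fun lam : WeightIndex n d d' => schurRep lam.1 (stdRep K V))
    (fun lam => isIrreducible_schurRep e (hanti lam.1 lam.2))
    (fun lam mu ⟨φ⟩ => Subtype.ext (eq_of_schurRep_equiv e (hanti lam.1 lam.2) (hanti mu.1 mu.2) φ))
    e (mulMap K V d (d' - d)) (mulMap_surjective (K := K) (V := V) d (d' - d)) huniq
    (fun lam => isHighestWeightVector_schurVec e (hanti lam.1 lam.2))
    (fun lam u hlam hu => ?_) fun lam => ?_
  · obtain ⟨ho, he⟩ := IsHighestWeightVector.sum_parts (K := K) (V := V) hu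
    exact ⟨⟨lam, mem_weightIndex_iff.mpr ⟨hlam, by omega, he⟩⟩, rfl⟩
  · obtain ⟨h, ho, he⟩ := mem_weightIndex_iff.mp lam.2
    obtain ⟨Θ, hΘ⟩ := exists_isCellPairing (d := d) (k := d' - d) h (by omega) he
    exact ⟨schurToSymTensor K V Θ, schurToSymTensor_schurVec_ne_zero e hΘ⟩

end
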